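/- Conventions. Let $(\Omega,\leqslant)$ be a totally ordered set. An $\ell$-permutation group $(G,\Omega)$ is a subgroup $G$ of $\mathrm{Aut}(\Omega,\leqslant)$ that is closed under pointwise maximum $\vee$ and pointwise minimum $\wedge$. A convex congruence is a $G$-invariant equivalence relation on $\Omega$ with convex classes; its classes are called o-blocks. Convex congruences are ordered by inclusion. For $\alpha\neq\beta$ in $\Omega$ let $V(\alpha,\beta)$ be the intersection of all convex congruences having $\alpha,\beta$ in one class. The spine of $(G,\Omega)$ is $\mathfrak K_G=\{V(\alpha,\beta)\mid \alpha\ne\beta\}$, ordered by inclusion; if $G$ is transitive on $\Omega$, it is totally ordered. Let $T_G$ be the set of o-blocks of members of $\mathfrak K_G$, ordered by inclusion. For a set $\Delta\subseteq\Omega$ write $\mathrm{st}(\Delta)=\{g\in G\mid \Delta g=\Delta\}$. If $\Delta\in T_G$ is an o-block of $\mathcal C\in\mathfrak K_G$, let $\pi(\Delta)$ be the set, ordered as inherited from $\Omega$, of those classes of the convex congruence covered by $\mathcal C$ that are contained in $\Delta$, and let $G(\Delta)$ be the $\ell$-permutation group of all automorphisms of $\pi(\Delta)$ induced by elements of $\mathrm{st}(\Delta)$.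 The $\ell$-permutation groups $(G(\Delta),\pi(\Delta))$ with $\Delta\in T_G$ are the o-primitive components of $(G,\Omega)$. An $\ell$-permutation group is o-$2$ transitive if it is transitive on pairs $(\alpha,\beta)$ with $\alpha<\beta$. An element $g>1$ of an $\ell$-group is irreducible if $g_1\vee g_2=g$ and $g_1\wedge g_2=1$ imply $g_1=1$ or $g_2=1$. We say that $(G,\Omega)$ is abundant if for all $\Delta\in T_G$ and $g\in\mathrm{st}(\Delta)$ the automorphism of $\Omega$ that agrees with $g$ on $\Delta$ and with the identity elsewhere belongs to $G$. Consider the following conditions: $(\dagger)$ if $T_G$ has a minimal element $\Delta$, then for each bounded interval $\Lambda\subseteq\Delta$ with more than one point there is $g\in G$ with $g\neq1$ and $\mathrm{supp}(g)\subseteq\Lambda$; $(\dagger\dagger)$ each o-$2$ transitive o-primitive component of $(G,\Omega)$ has irreducible elements. **Corollary.** Let $(G,\Omega)$ be an abundant transitive $\ell$-permutation group that satisfies $(\dagger)$ and $(\dagger\dagger)$, and let $(H,\Lambda)$ be an abundant transitive $\ell$-permutation group that satisfies $(\dagger)$. If $G$ and $H$ are elementarily equivalent in the first-order language of lattice-ordered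 groups (with operations $\cdot,{}^{-1},1,\vee,\wedge$), then $(H,\Lambda)$ satisfies $(\dagger\dagger)$, and $\mathfrak K_G$ and $\mathfrak K_H$ are elementarily equivalent as totally ordered sets. -/

import Mathlib

/-! ### The lattice `Aut(Ω, ≤)` -/

section AutLattice

variable {Ω : Type*} [LinearOrder Ω]

/-- The pointwise maximum of two order automorphisms of a totally ordered set. -/
def autSup (f g : Ω ≃o Ω) : Ω ≃o Ω where
  toFun x := max (f x) (g x)
  invFun x := min (f.symm x) (g.symm x)
  left_inv x := by
    rcases le_total (f x) (g x) with h | h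
    · have h' : x ≤ f.symm (g x) := f.le_symm_apply.2 h
      simp [max_eq_right h, h']
    · have h' : x ≤ g.symm (f x) := g.le_symm_apply.2 h
      simp [max_eq_left h, h']
  right_inv x := by
    rcases le_total (f.symm x) (g.symm x) with h | h
    · have h' : g (f.symm x) ≤ x := g.le_symm_apply.1 h
      simp [min_eq_left h, h']
    · have h' : f (g.symm x) ≤ x := f.le_symm_apply.1 h
      simp [min_eq_right h, h']
  map_rel_iff' := by
    intro a b
    constructor
    · intro h
      by_contra hab
      have hba := not_le.1 hab
      exact absurd h (not_le.2 (max_lt_max (f.strictMono hba) (g.strictMono hba)))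
    · intro h
      exact max_le_max (f.monotone h) (g.monotone h)

/-- The pointwise minimum of two order automorphisms of a totally ordered set. -/
def autInf (f g : Ω ≃o Ω) : Ω ≃o Ω where
  toFun x := min (f x) (g x)
  invFun x := max (f.symm x) (g.symm x)
  left_inv x := by
    rcases le_total (f x) (g x) with h | h
    · have h' : g.symm (f x) ≤ x := g.symm_apply_le.2 h
      simp [min_eq_left h, h']
    · have h' : f.symm (g x) ≤ x := f.symm_apply_le.2 h
      simp [min_eq_right h, h']
  right_inv x := by
    rcases le_total (f.symm x) (g.symm x) with h | h
    · have h' : x ≤ f (g.symm x) := f.symm_apply_le.1 h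
      simp [max_eq_right h, h']
    · have h' : x ≤ g (f.symm x) := g.symm_apply_le.1 h
      simp [max_eq_left h, h']
  map_rel_iff' := by
    intro a b
    constructor
    · intro h
      by_contra hab
      have hba := not_le.1 hab
      exact absurd h (not_le.2 (min_lt_min (f.strictMono hba) (g.strictMono hba)))
    · intro h
      exact min_le_min (f.monotone h) (g.monotone h)

/-- `Aut(Ω, ≤)` is a lattice under the pointwise order. -/
instance autLattice : Lattice (Ω ≃o Ω) where
  le f g := ∀ x, f x ≤ g x
  le_refl f x := le_refl (f x)
  le_trans f g h h₁ h₂ x := le_trans (h₁ x) (h₂ x)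
  le_antisymm f g h₁ h₂ := by
    ext x
    exact le_antisymm (h₁ x) (h₂ x)
  sup := autSup
  inf := autInf
  le_sup_left f g x := le_max_left (f x) (g x)
  le_sup_right f g x := le_max_right (f x) (g x)
  sup_le f g h h₁ h₂ x := max_le (h₁ x) (h₂ x)
  inf_le_left f g x := min_le_left (f x) (g x)
  inf_le_right f g x := min_le_right (f x) (g x)
  le_inf f g h h₁ h₂ x := le_min (h₁ x) (h₂ x)

theorem aut_sup_apply (f g : Ω ≃o Ω) (x : Ω) : (f ⊔ g) x = max (f x) (g x) := rfl

theorem aut_inf_apply (f g : Ω ≃o Ω) (x : Ω) : (f ⊓ g) x = min (f x) (g x) := rfl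

end AutLattice

/-! ### Lattice-ordered permutation groups -/

/-- An `ℓ`-permutation group `(G, Ω)`: a subgroup of `Aut(Ω, ≤)` that is also a sublattice. -/
structure LPermGroup (Ω : Type*) [LinearOrder Ω] extends Subgroup (Ω ≃o Ω) where
  sup_mem' : ∀ {f g : Ω ≃o Ω}, f ∈ carrier → g ∈ carrier → f ⊔ g ∈ carrier
  inf_mem' : ∀ {f g : Ω ≃o Ω}, f ∈ carrier → g ∈ carrier → f ⊓ g ∈ carrier

/-- `g` is irreducible: `g > 1`, and `g` is not the join of two nontrivial disjoint elements. -/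
def IsIrreducibleElement {M : Type*} [Group M] [Lattice M] (g : M) : Prop :=
  1 < g ∧ ∀ g₁ g₂ : M, g₁ ⊔ g₂ = g → g₁ ⊓ g₂ = 1 → g₁ = 1 ∨ g₂ = 1

/-- A convex `G`-congruence on `Ω`: a `G`-invariant equivalence relation with convex classes. -/
structure ConvexCongruence {Ω : Type*} [LinearOrder Ω] (G : LPermGroup Ω) extends Setoid Ω where
  map' : ∀ g ∈ G.toSubgroup, ∀ a b : Ω, toSetoid a b → toSetoid (g a) (g b)
  convex' : ∀ a : Ω, Set.OrdConnected {b | toSetoid a b}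

namespace ConvexCongruence

variable {Ω : Type*} [LinearOrder Ω] {G : LPermGroup Ω}

theorem toSetoid_injective :
    Function.Injective (ConvexCongruence.toSetoid : ConvexCongruence G → Setoid Ω) := by
  rintro ⟨r, _, _⟩ ⟨s, _, _⟩ h
  cases h
  rfl

/-- Convex congruences are ordered by inclusion. -/
instance : PartialOrder (ConvexCongruence G) :=
  PartialOrder.lift ConvexCongruence.toSetoid toSetoid_injective

/-- The o-block of `C` that contains `α`. -/
def block (C : ConvexCongruence G) (α : Ω) : Set Ω := {β | C.toSetoid α β}

/-- For o-blocks `Δ` of a congruence containing `D`, this is `π(Δ)`, the set of `D`-classes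
contained in `Δ`, where `D` is the congruence covered by that of `Δ`. -/
def BlockQuotient (D : ConvexCongruence G) (Δ : Set Ω) : Type _ :=
  Quotient (D.toSetoid.comap (Subtype.val : Δ → Ω))

/-- The `D`-class of a point of `Δ`. -/
def BlockQuotient.mk (D : ConvexCongruence G) (Δ : Set Ω) (x : Δ) : D.BlockQuotient Δ :=
  Quotient.mk (D.toSetoid.comap (Subtype.val : Δ → Ω)) x

theorem BlockQuotient.mk_eq_iff (D : ConvexCongruence G) (Δ : Set Ω) (x y : Δ) :
    BlockQuotient.mk D Δ x = BlockQuotient.mk D Δ y ↔ D.toSetoid x.1 y.1 :=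
  Quotient.eq (r := D.toSetoid.comap (Subtype.val : Δ → Ω))

theorem BlockQuotient.mk_surjective (D : ConvexCongruence G) (Δ : Set Ω) :
    Function.Surjective (BlockQuotient.mk D Δ) :=
  Quotient.mk_surjective

theorem le_or_rel_congr (D : ConvexCongruence G) {a a' b b' : Ω} (ha : D.toSetoid a a')
    (hb : D.toSetoid b b') (h : a ≤ b ∨ D.toSetoid a b) : a' ≤ b' ∨ D.toSetoid a' b' := by
  have tr : ∀ {x y z : Ω}, D.toSetoid x y → D.toSetoid y z → D.toSetoid x z :=
    fun h₁ h₂ => D.toSetoid.trans' h₁ h₂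
  have sy : ∀ {x y : Ω}, D.toSetoid x y → D.toSetoid y x := fun h₁ => D.toSetoid.symm' h₁
  have rf : ∀ x : Ω, D.toSetoid x x := fun x => D.toSetoid.refl' x
  rcases h with h | h
  · by_cases hle : a' ≤ b'
    · exact Or.inl hle
    · right
      have hlt := not_le.1 hle
      rcases le_total b a' with hba | hba
      · have : D.toSetoid a b := (D.convex' a).out (rf a) ha ⟨h, hba⟩
        exact tr (sy ha) (tr this hb)
      · have : D.toSetoid b a' := (D.convex' b).out hb (rf b) ⟨hlt.le, hba⟩
        exact sy (tr (sy hb) this)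
  · exact Or.inr (tr (sy ha) (tr h hb))

/-- The total order that the set of `D`-classes in `Δ` inherits from `Ω`: the class of `x` is at
most the class of `y` if and only if `x ≤ y` or the two classes are equal. -/
noncomputable instance (D : ConvexCongruence G) (Δ : Set Ω) :
    LinearOrder (D.BlockQuotient Δ) where
  le p q := Quotient.liftOn₂ p q (fun x y => x.1 ≤ y.1 ∨ D.toSetoid x.1 y.1) (by
    intro a b a' b' ha hb
    exact propext ⟨fun h => D.le_or_rel_congr ha hb h,
      fun h => D.le_or_rel_congr (D.toSetoid.symm' ha) (D.toSetoid.symm' hb) h⟩)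
  le_refl p := by
    induction p using Quotient.inductionOn with
    | _ a => exact Or.inl (le_refl a.1)
  le_trans p q r := by
    induction p using Quotient.inductionOn with
    | _ a =>
    induction q using Quotient.inductionOn with
    | _ b =>
    induction r using Quotient.inductionOn with
    | _ c =>
    intro h₁ h₂
    change a.1 ≤ b.1 ∨ D.toSetoid a.1 b.1 at h₁
    change b.1 ≤ c.1 ∨ D.toSetoid b.1 c.1 at h₂
    change a.1 ≤ c.1 ∨ D.toSetoid a.1 c.1
    rcases h₁ with h₁ | h₁
    · rcases h₂ with h₂ | h₂
      · exact Or.inl (h₁.trans h₂)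
      · exact D.le_or_rel_congr (D.toSetoid.refl' a.1) h₂ (Or.inl h₁)
    · exact D.le_or_rel_congr (D.toSetoid.symm' h₁) (D.toSetoid.refl' c.1) h₂
  le_antisymm p q := by
    induction p using Quotient.inductionOn with
    | _ a =>
    induction q using Quotient.inductionOn with
    | _ b =>
    intro h₁ h₂
    change a.1 ≤ b.1 ∨ D.toSetoid a.1 b.1 at h₁
    change b.1 ≤ a.1 ∨ D.toSetoid b.1 a.1 at h₂
    apply Quotient.sound
    change D.toSetoid a.1 b.1
    rcases h₁ with h₁ | h₁
    · rcases h₂ with h₂ | h₂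
      · rw [le_antisymm h₁ h₂]
      · exact D.toSetoid.symm' h₂
    · exact h₁
  le_total p q := by
    induction p using Quotient.inductionOn with
    | _ a =>
    induction q using Quotient.inductionOn with
    | _ b =>
    rcases le_total a.1 b.1 with h | h
    · exact Or.inl (Or.inl h)
    · exact Or.inr (Or.inl h)
  toDecidableLE := Classical.decRel _

theorem BlockQuotient.mk_le_iff (D : ConvexCongruence G) (Δ : Set Ω) (x y : Δ) :
    BlockQuotient.mk D Δ x ≤ BlockQuotient.mk D Δ y ↔ x.1 ≤ y.1 ∨ D.toSetoid x.1 y.1 :=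
  Iff.rfl

theorem BlockQuotient.mk_mono (D : ConvexCongruence G) (Δ : Set Ω) :
    Monotone (BlockQuotient.mk D Δ) :=
  fun _ _ h => Or.inl h

end ConvexCongruence

namespace LPermGroup

variable {Ω : Type*} [LinearOrder Ω]

/-- An `ℓ`-permutation group, regarded as a group, is a lattice under the pointwise operations. -/
instance (G : LPermGroup Ω) : Lattice G.toSubgroup :=
  Subtype.lattice (P := fun f => f ∈ G.toSubgroup)
    (fun {_ _} hf hg => G.sup_mem' hf hg) (fun {_ _} hf hg => G.inf_mem' hf hg)

/-- `G` acts transitively on `Ω`. -/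
def IsTransitive (G : LPermGroup Ω) : Prop :=
  ∀ α β : Ω, ∃ g ∈ G.toSubgroup, g α = β

/-- `G` is transitive on pairs `(α, β)` with `α < β`. -/
def IsO2Transitive (G : LPermGroup Ω) : Prop :=
  ∀ α β α' β' : Ω, α < β → α' < β' → ∃ g ∈ G.toSubgroup, g α = α' ∧ g β = β'

/-- `V(α, β)`: the intersection of all convex congruences with `α`, `β` in the same o-block. -/
def V (G : LPermGroup Ω) (α β : Ω) : ConvexCongruence G where
  r x y := ∀ C : ConvexCongruence G, C.toSetoid α β → C.toSetoid x y
  iseqv :=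
    { refl := fun x C _ => C.toSetoid.refl' x
      symm := fun h C hC => C.toSetoid.symm' (h C hC)
      trans := fun h₁ h₂ C hC => C.toSetoid.trans' (h₁ C hC) (h₂ C hC) }
  map' g hg a b h C hC := C.map' g hg a b (h C hC)
  convex' a := ⟨fun _ hx _ hy _ hz C hC => (C.convex' a).out (hx C hC) (hy C hC) hz⟩

/-- The spine `𝔎` of `(G, Ω)`, the set of all `V(α, β)` with `α ≠ β`, ordered by inclusion. -/
def spine (G : LPermGroup Ω) : Set (ConvexCongruence G) :=
  {C | ∃ α β : Ω, α ≠ β ∧ C = G.V α β}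

/-- The root system `T` of `(G, Ω)`: all o-blocks of members of the spine. -/
def rootSystem (G : LPermGroup Ω) : Set (Set Ω) :=
  {Δ | ∃ C ∈ G.spine, ∃ α : Ω, Δ = C.block α}

/-- The stabilizer `st(Δ)` of a set `Δ`. -/
def st (G : LPermGroup Ω) (Δ : Set Ω) : Set (Ω ≃o Ω) :=
  {g | g ∈ G.toSubgroup ∧ ∀ x, g x ∈ Δ ↔ x ∈ Δ}

/-- `(G, Ω)` is abundant: for `Δ ∈ T` and `g ∈ st(Δ)`, the automorphism that agrees with `g` on
`Δ` and with the identity elsewhere belongs to `G`. -/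
def IsAbundant (G : LPermGroup Ω) : Prop :=
  ∀ Δ ∈ G.rootSystem, ∀ g ∈ G.st Δ,
    ∃ d ∈ G.toSubgroup, (∀ x ∈ Δ, d x = g x) ∧ ∀ x ∉ Δ, d x = x

/-- Hypothesis `(†)`: if `Δ` is a minimal element of `T`, then every nondegenerate bounded interval
in `Δ` contains the support of a nontrivial element of `G`. -/
def Dagger (G : LPermGroup Ω) : Prop :=
  ∀ Δ, Minimal (· ∈ G.rootSystem) Δ → ∀ α ∈ Δ, ∀ β ∈ Δ, α < β →
    ∃ g ∈ G.toSubgroup, g ≠ 1 ∧ {x | g x ≠ x} ⊆ Set.Icc α β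

/-- The `ℓ`-permutation group `(G(Δ), π(Δ))` of all automorphisms of the set `π(Δ)` of `D`-classes
in `Δ` that are induced by elements of `st(Δ)`. -/
def component (G : LPermGroup Ω) (D : ConvexCongruence G) (Δ : Set Ω) :
    LPermGroup (D.BlockQuotient Δ) where
  carrier := {φ | ∃ g ∈ G.st Δ, ∀ x y : Δ, g x.1 = y.1 →
    φ (ConvexCongruence.BlockQuotient.mk D Δ x) = ConvexCongruence.BlockQuotient.mk D Δ y}
  one_mem' := ⟨1, ⟨G.toSubgroup.one_mem, fun _ => Iff.rfl⟩, fun x y h => by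
    have : x = y := Subtype.ext h
    rw [this]; rfl⟩
  mul_mem' := by
    rintro φ ψ ⟨g, hg, hφ⟩ ⟨h, hh, hψ⟩
    refine ⟨g * h, ⟨G.toSubgroup.mul_mem hg.1 hh.1, fun x => (hg.2 (h x)).trans (hh.2 x)⟩, ?_⟩
    intro x z hz
    have e₁ := hψ x ⟨h x.1, (hh.2 x.1).2 x.2⟩ rfl
    have e₂ := hφ ⟨h x.1, (hh.2 x.1).2 x.2⟩ z hz
    change φ (ψ _) = _
    rw [e₁, e₂]
  inv_mem' := by
    rintro φ ⟨g, hg, hφ⟩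
    refine ⟨g⁻¹, ⟨G.toSubgroup.inv_mem hg.1, fun x => ?_⟩, ?_⟩
    · have := hg.2 (g⁻¹ x)
      rw [RelIso.apply_inv_self] at this
      exact this.symm
    · intro x y hxy
      have h : g y.1 = x.1 := by
        rw [← hxy, RelIso.apply_inv_self]
      rw [← hφ y x h, RelIso.inv_apply_self]
  sup_mem' := by
    rintro φ ψ ⟨g, hg, hφ⟩ ⟨h, hh, hψ⟩
    refine ⟨g ⊔ h, ⟨G.sup_mem' hg.1 hh.1, fun x => ?_⟩, ?_⟩
    · rw [aut_sup_apply]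
      rcases max_choice (g x) (h x) with e | e <;> rw [e]
      exacts [hg.2 x, hh.2 x]
    · intro x y hxy
      rw [aut_sup_apply] at hxy ⊢
      rcases le_total (g x.1) (h x.1) with e | e
      · rw [max_eq_right e] at hxy
        rw [hφ x ⟨g x.1, (hg.2 x.1).2 x.2⟩ rfl, hψ x y hxy]
        exact max_eq_right (Or.inl (e.trans_eq hxy))
      · rw [max_eq_left e] at hxy
        rw [hφ x y hxy, hψ x ⟨h x.1, (hh.2 x.1).2 x.2⟩ rfl]
        exact max_eq_left (Or.inl (e.trans_eq hxy))
  inf_mem' := by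
    rintro φ ψ ⟨g, hg, hφ⟩ ⟨h, hh, hψ⟩
    refine ⟨g ⊓ h, ⟨G.inf_mem' hg.1 hh.1, fun x => ?_⟩, ?_⟩
    · rw [aut_inf_apply]
      rcases min_choice (g x) (h x) with e | e <;> rw [e]
      exacts [hg.2 x, hh.2 x]
    · intro x y hxy
      rw [aut_inf_apply] at hxy ⊢
      rcases le_total (g x.1) (h x.1) with e | e
      · rw [min_eq_left e] at hxy
        rw [hφ x y hxy, hψ x ⟨h x.1, (hh.2 x.1).2 x.2⟩ rfl]
        exact min_eq_left (Or.inl (hxy.symm.trans_le e))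
      · rw [min_eq_right e] at hxy
        rw [hφ x ⟨g x.1, (hg.2 x.1).2 x.2⟩ rfl, hψ x y hxy]
        exact min_eq_right (Or.inl (hxy.symm.trans_le e))

/-- Hypothesis `(††)`: every o-2 transitive o-primitive component has irreducible elements. The
o-primitive components are the `(G(Δ), π(Δ))`, where `Δ` is an o-block of some `C ∈ 𝔎` and `D` is
the convex congruence covered by `C`. -/
def DoubleDagger (G : LPermGroup Ω) : Prop :=
  ∀ C ∈ G.spine, ∀ D : ConvexCongruence G, D ⋖ C → ∀ α : Ω,
    (G.component D (C.block α)).IsO2Transitive →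
      ∃ g : (G.component D (C.block α)).toSubgroup, IsIrreducibleElement g

end LPermGroup

/-! ### First-order languages -/

/-- The operation symbols of the language of lattice-ordered groups. -/
inductive LGroupFunc : ℕ → Type
  | one : LGroupFunc 0
  | inv : LGroupFunc 1
  | mul : LGroupFunc 2
  | sup : LGroupFunc 2
  | inf : LGroupFunc 2

/-- The first-order language of lattice-ordered groups. -/
def lgroupLanguage : FirstOrder.Language := ⟨LGroupFunc, fun _ => Empty⟩

/-- The interpretation of the language of lattice-ordered groups in a group with a lattice order. -/
instance lgroupStructure (M : Type*) [Group M] [Lattice M] : lgroupLanguage.Structure M where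
  funMap := fun {_} f =>
    match f with
    | LGroupFunc.one => fun _ => 1
    | LGroupFunc.inv => fun v => (v 0)⁻¹
    | LGroupFunc.mul => fun v => v 0 * v 1
    | LGroupFunc.sup => fun v => v 0 ⊔ v 1
    | LGroupFunc.inf => fun v => v 0 ⊓ v 1
  RelMap := fun {_} r => r.elim

/-- Elementary equivalence in the first-order language of lattice-ordered groups. -/
def LGroupElemEquiv (M N : Type*) [Group M] [Lattice M] [Group N] [Lattice N] : Prop :=
  lgroupLanguage.ElementarilyEquivalent M N

/-- Elementary equivalence in the first-order language of ordered sets. -/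
def OrderElemEquiv (A B : Type*) [LE A] [LE B] : Prop :=
  letI := FirstOrder.Language.orderStructure A
  letI := FirstOrder.Language.orderStructure B
  FirstOrder.Language.order.ElementarilyEquivalent A B

/-! ### Simultaneous definability in two lattice-ordered groups -/

/-! The root system, and with it the spine and the o-primitive components, can be recovered from the
ℓ-group by formulas that do not depend on the group. Elementary equivalence then transfers whatever
these formulas express.

Two elements are orthogonal exactly when their supports are disjoint (`perp_iff`), so a double polar
consists of all elements supported on some set. For Δ ∈ T one can choose g supported on Δ such that
the conjugates of g not orthogonal to g, which are again supported on Δ, together move every point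
of Δ. Their double polar, the hull of g, is then the set of all elements of G supported on Δ
(`exists_represents`). The choice of g rests on a dichotomy (`isO2Transitive_or_exists_bump`): an
o-primitive component is o-2 transitive, so that conjugates of one bump can be stretched over any
two points, or some element of it has a single bump that is everything.

Conversely, the conditions in `IsBlockParam` force a hull to be supported on a class of a convex
congruence E (`exists_represents_of_isBlockParam`). Such an E belongs to the spine exactly when the
classes properly inside the given one do not form a nonempty directed family; this is what
`IsRootParam` adds (`isRootParam_iff`). By transitivity all blocks of one congruence are conjugate,
so the spine is the family of these hulls, ordered by inclusion up to conjugacy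
(`Represents.conjHullLE_iff`). This is an interpretation of the spine, and
`orderElemEquiv_of_interpretation` applies.

For (††), the second alternative of the dichotomy always yields an irreducible element, so (††) says
that every o-primitive component has irreducible elements (`doubleDagger_iff`). Stabilizing Δ, and
acting trivially on π(Δ), can be expressed through hulls (`Represents.hasIrreducibleOnHull_iff`), so
(††) becomes a sentence about the ℓ-group. -/

section Definability

open FirstOrder FirstOrder.Language

variable {M N : Type*} [Group M] [Lattice M] [Group N] [Lattice N] {α β : Type}

/-- `t` and `s` are the interpretations in `M` and `N` of one term. -/
def TermPair (t : (α → M) → M) (s : (α → N) → N) : Prop :=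
  ∃ τ : lgroupLanguage.Term α, (∀ v : α → M, τ.realize v = t v) ∧ ∀ v : α → N, τ.realize v = s v

/-- `P` and `Q` are defined in `M` and `N` by one first-order formula. -/
def DefPair (P : (α → M) → Prop) (Q : (α → N) → Prop) : Prop :=
  ∃ φ : lgroupLanguage.Formula α,
    (∀ v : α → M, φ.Realize v ↔ P v) ∧ ∀ v : α → N, φ.Realize v ↔ Q v

namespace TermPair

variable {t t' : (α → M) → M} {s s' : (α → N) → N}

theorem var (a : α) : TermPair (fun v : α → M => v a) (fun v : α → N => v a) :=
  ⟨Term.var a, fun _ => rfl, fun _ => rfl⟩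

theorem one : TermPair (fun _ : α → M => 1) (fun _ : α → N => 1) :=
  ⟨Term.func (L := lgroupLanguage) (l := 0) LGroupFunc.one Fin.elim0, fun _ => rfl, fun _ => rfl⟩

theorem inv (h : TermPair t s) : TermPair (fun v => (t v)⁻¹) (fun v => (s v)⁻¹) := by
  obtain ⟨τ, h₁, h₂⟩ := h
  refine ⟨Term.func (L := lgroupLanguage) (l := 1) LGroupFunc.inv ![τ], fun v => ?_, fun v => ?_⟩
  · exact congrArg _ (h₁ v)
  · exact congrArg _ (h₂ v)

theorem mul (h : TermPair t s) (h' : TermPair t' s') :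
    TermPair (fun v => t v * t' v) (fun v => s v * s' v) := by
  obtain ⟨τ, h₁, h₂⟩ := h
  obtain ⟨τ', h₁', h₂'⟩ := h'
  refine ⟨Term.func (L := lgroupLanguage) (l := 2) LGroupFunc.mul ![τ, τ'],
    fun v => ?_, fun v => ?_⟩
  · exact congrArg₂ (· * ·) (h₁ v) (h₁' v)
  · exact congrArg₂ (· * ·) (h₂ v) (h₂' v)

theorem sup (h : TermPair t s) (h' : TermPair t' s') :
    TermPair (fun v => t v ⊔ t' v) (fun v => s v ⊔ s' v) := by
  obtain ⟨τ, h₁, h₂⟩ := h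
  obtain ⟨τ', h₁', h₂'⟩ := h'
  refine ⟨Term.func (L := lgroupLanguage) (l := 2) LGroupFunc.sup ![τ, τ'],
    fun v => ?_, fun v => ?_⟩
  · exact congrArg₂ (· ⊔ ·) (h₁ v) (h₁' v)
  · exact congrArg₂ (· ⊔ ·) (h₂ v) (h₂' v)

theorem inf (h : TermPair t s) (h' : TermPair t' s') :
    TermPair (fun v => t v ⊓ t' v) (fun v => s v ⊓ s' v) := by
  obtain ⟨τ, h₁, h₂⟩ := h
  obtain ⟨τ', h₁', h₂'⟩ := h'
  refine ⟨Term.func (L := lgroupLanguage) (l := 2) LGroupFunc.inf ![τ, τ'],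
    fun v => ?_, fun v => ?_⟩
  · exact congrArg₂ (· ⊓ ·) (h₁ v) (h₁' v)
  · exact congrArg₂ (· ⊓ ·) (h₂ v) (h₂' v)

theorem conj (h : TermPair t s) (h' : TermPair t' s') :
    TermPair (fun v => t v * t' v * (t v)⁻¹) (fun v => s v * s' v * (s v)⁻¹) :=
  (h.mul h').mul h.inv

theorem weaken (h : TermPair t s) :
    TermPair (fun v : α ⊕ Unit → M => t fun a => v (Sum.inl a))
      (fun v : α ⊕ Unit → N => s fun a => v (Sum.inl a)) := by
  obtain ⟨τ, h₁, h₂⟩ := h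
  refine ⟨τ.relabel Sum.inl, fun v => ?_, fun v => ?_⟩
  · rw [Term.realize_relabel]; exact h₁ _
  · rw [Term.realize_relabel]; exact h₂ _

theorem last : TermPair (fun v : α ⊕ Unit → M => v (Sum.inr ()))
    (fun v : α ⊕ Unit → N => v (Sum.inr ())) :=
  var _

end TermPair

namespace DefPair

variable {P P' : (α → M) → Prop} {Q Q' : (α → N) → Prop}

theorem congr (h : DefPair P Q) (hP : ∀ v, P v ↔ P' v) (hQ : ∀ v, Q v ↔ Q' v) :
    DefPair P' Q' := by
  obtain ⟨φ, h₁, h₂⟩ := h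
  exact ⟨φ, fun v => (h₁ v).trans (hP v), fun v => (h₂ v).trans (hQ v)⟩

theorem eq {t t' : (α → M) → M} {s s' : (α → N) → N} (h : TermPair t s) (h' : TermPair t' s') :
    DefPair (fun v => t v = t' v) (fun v => s v = s' v) := by
  obtain ⟨τ, h₁, h₂⟩ := h
  obtain ⟨τ', h₁', h₂'⟩ := h'
  exact ⟨τ.equal τ', fun v => by rw [Formula.realize_equal, h₁, h₁'],
    fun v => by rw [Formula.realize_equal, h₂, h₂']⟩

theorem ne {t t' : (α → M) → M} {s s' : (α → N) → N} (h : TermPair t s) (h' : TermPair t' s') :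
    DefPair (fun v => t v ≠ t' v) (fun v => s v ≠ s' v) := by
  obtain ⟨φ, h₁, h₂⟩ := eq h h'
  exact ⟨φ.not, fun v => (h₁ v).not, fun v => (h₂ v).not⟩

theorem le {t t' : (α → M) → M} {s s' : (α → N) → N} (h : TermPair t s) (h' : TermPair t' s') :
    DefPair (fun v => t v ≤ t' v) (fun v => s v ≤ s' v) :=
  (eq (h.sup h') h').congr (fun _ => sup_eq_right) (fun _ => sup_eq_right)

theorem not (h : DefPair P Q) : DefPair (fun v => ¬ P v) (fun v => ¬ Q v) := by
  obtain ⟨φ, h₁, h₂⟩ := h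
  exact ⟨φ.not, fun v => (h₁ v).not, fun v => (h₂ v).not⟩

theorem false : DefPair (fun _ : α → M => False) (fun _ : α → N => False) :=
  ⟨⊥, fun _ => Iff.rfl, fun _ => Iff.rfl⟩

theorem imp (h : DefPair P Q) (h' : DefPair P' Q') :
    DefPair (fun v => P v → P' v) (fun v => Q v → Q' v) := by
  obtain ⟨φ, h₁, h₂⟩ := h
  obtain ⟨φ', h₁', h₂'⟩ := h'
  exact ⟨φ.imp φ', fun v => by rw [Formula.realize_imp, h₁, h₁'],
    fun v => by rw [Formula.realize_imp, h₂, h₂']⟩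

theorem and (h : DefPair P Q) (h' : DefPair P' Q') :
    DefPair (fun v => P v ∧ P' v) (fun v => Q v ∧ Q' v) :=
  (h.imp h'.not).not.congr (fun _ => by tauto) (fun _ => by tauto)

theorem or (h : DefPair P Q) (h' : DefPair P' Q') :
    DefPair (fun v => P v ∨ P' v) (fun v => Q v ∨ Q' v) :=
  (h.not.imp h').congr (fun _ => by tauto) (fun _ => by tauto)

theorem iff (h : DefPair P Q) (h' : DefPair P' Q') :
    DefPair (fun v => P v ↔ P' v) (fun v => Q v ↔ Q' v) :=
  ((h.imp h').and (h'.imp h)).congr (fun _ => by tauto) (fun _ => by tauto)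

theorem all {P : (α → M) → M → Prop} {Q : (α → N) → N → Prop}
    (h : DefPair (fun v : α ⊕ Unit → M => P (fun a => v (Sum.inl a)) (v (Sum.inr ())))
      (fun v : α ⊕ Unit → N => Q (fun a => v (Sum.inl a)) (v (Sum.inr ())))) :
    DefPair (fun v => ∀ x, P v x) (fun v => ∀ x, Q v x) := by
  obtain ⟨φ, h₁, h₂⟩ := h
  refine ⟨φ.iAlls Unit, fun v => ?_, fun v => ?_⟩
  · rw [Formula.realize_iAlls]
    exact ⟨fun h x => (h₁ _).1 (h fun _ => x), fun h i => (h₁ _).2 (h (i ()))⟩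
  · rw [Formula.realize_iAlls]
    exact ⟨fun h x => (h₂ _).1 (h fun _ => x), fun h i => (h₂ _).2 (h (i ()))⟩

theorem ex {P : (α → M) → M → Prop} {Q : (α → N) → N → Prop}
    (h : DefPair (fun v : α ⊕ Unit → M => P (fun a => v (Sum.inl a)) (v (Sum.inr ())))
      (fun v : α ⊕ Unit → N => Q (fun a => v (Sum.inl a)) (v (Sum.inr ())))) :
    DefPair (fun v => ∃ x, P v x) (fun v => ∃ x, Q v x) := by
  obtain ⟨φ, h₁, h₂⟩ := h
  refine ⟨φ.iExs Unit, fun v => ?_, fun v => ?_⟩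
  · rw [Formula.realize_iExs]
    exact ⟨fun ⟨i, h⟩ => ⟨i (), (h₁ _).1 h⟩, fun ⟨x, h⟩ => ⟨fun _ => x, (h₁ _).2 h⟩⟩
  · rw [Formula.realize_iExs]
    exact ⟨fun ⟨i, h⟩ => ⟨i (), (h₂ _).1 h⟩, fun ⟨x, h⟩ => ⟨fun _ => x, (h₂ _).2 h⟩⟩

theorem subst {P : (β → M) → Prop} {Q : (β → N) → Prop} (h : DefPair P Q)
    {t : β → (α → M) → M} {s : β → (α → N) → N} (ht : ∀ b, TermPair (t b) (s b)) :
    DefPair (fun v => P fun b => t b v) (fun v => Q fun b => s b v) := by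
  obtain ⟨φ, h₁, h₂⟩ := h
  choose τ hτ₁ hτ₂ using ht
  refine ⟨BoundedFormula.subst φ τ, fun v => ?_, fun v => ?_⟩
  · refine Iff.trans ?_ (h₁ _)
    rw [Formula.Realize, Formula.Realize, BoundedFormula.realize_subst]
    simp only [hτ₁]
  · refine Iff.trans ?_ (h₂ _)
    rw [Formula.Realize, Formula.Realize, BoundedFormula.realize_subst]
    simp only [hτ₂]

/-- Elementarily equivalent `ℓ`-groups satisfy the same sentences. -/
theorem iff_of_elemEquiv (hMN : LGroupElemEquiv M N) {p q : Prop}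
    (h : DefPair (fun _ : Empty → M => p) (fun _ : Empty → N => q)) : p ↔ q := by
  obtain ⟨φ, h₁, h₂⟩ := h
  exact (h₁ default).symm.trans ((elementarilyEquivalent_iff.1 hMN φ).trans (h₂ default))

end DefPair

/-- An ordered set interpreted by one pair of formulas in two elementarily equivalent `ℓ`-groups:
the relation `R` says which elements of the group represent an element of the ordered set. -/
theorem orderElemEquiv_of_interpretation {A B : Type*} [PartialOrder A] [PartialOrder B]
    (hMN : LGroupElemEquiv M N) {R : M → A → Prop} {S : N → B → Prop}
    {d : M → Prop} {d' : N → Prop} {e : M → M → Prop} {e' : N → N → Prop}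
    (hd : DefPair (fun v : Unit → M => d (v ())) (fun v : Unit → N => d' (v ())))
    (he : DefPair (fun v : Bool → M => e (v false) (v true))
      (fun v : Bool → N => e' (v false) (v true)))
    (hR : ∀ a, ∃ x, R x a) (hS : ∀ a, ∃ x, S x a)
    (hdR : ∀ x, d x ↔ ∃ a, R x a) (hdS : ∀ x, d' x ↔ ∃ a, S x a)
    (heR : ∀ x y a b, R x a → R y b → (e x y ↔ a ≤ b))
    (heS : ∀ x y a b, S x a → S y b → (e' x y ↔ a ≤ b)) :
    OrderElemEquiv A B := by
  let := FirstOrder.Language.orderStructure A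
  let := FirstOrder.Language.orderStructure B
  have he₂ : ∀ {n : ℕ} (i j : Fin n),
      DefPair (fun v : Fin n → M => e (v i) (v j)) (fun v : Fin n → N => e' (v i) (v j)) :=
    fun i j => he.subst (t := fun b v => cond b (v j) (v i)) (s := fun b v => cond b (v j) (v i))
      fun b => by cases b <;> exact .var _
  -- Induction on φ, with quantifiers relativized to `d` and `d'`. The truth values of P and Q on
  -- representatives depend only on the represented elements, which lets the quantifier step choose
  -- any representative.
  have key : ∀ {n : ℕ} (φ : FirstOrder.Language.order.BoundedFormula Empty n),
      ∃ (P : (Fin n → M) → Prop) (Q : (Fin n → N) → Prop), DefPair P Q ∧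
        (∀ v a, (∀ i, R (v i) (a i)) → (P v ↔ φ.Realize default a)) ∧
        ∀ v a, (∀ i, S (v i) (a i)) → (Q v ↔ φ.Realize default a) := by
    have hvar : ∀ {n : ℕ} (t : FirstOrder.Language.order.Term (Empty ⊕ Fin n)),
        ∃ i, t = Term.var (Sum.inr i) := by
      intro n t
      cases t with
      | var x =>
        rcases x with x | x
        · exact x.elim
        · exact ⟨x, rfl⟩
      | func f _ => exact isEmptyElim f
    intro n φ
    induction φ with
    | falsum => exact ⟨_, _, .false, fun _ _ _ => Iff.rfl, fun _ _ _ => Iff.rfl⟩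
    | equal t₁ t₂ =>
      obtain ⟨i, rfl⟩ := hvar t₁
      obtain ⟨j, rfl⟩ := hvar t₂
      -- An element of the order has many representatives, so equality is interpreted by `e` in both
      -- directions.
      refine ⟨_, _, (he₂ i j).and (he₂ j i), fun v a h => ?_, fun v a h => ?_⟩
      · rw [heR _ _ _ _ (h i) (h j), heR _ _ _ _ (h j) (h i)]
        exact le_antisymm_iff.symm
      · rw [heS _ _ _ _ (h i) (h j), heS _ _ _ _ (h j) (h i)]
        exact le_antisymm_iff.symm
    | @rel n l r ts =>
      cases r
      obtain ⟨i, hi⟩ := hvar (ts 0)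
      obtain ⟨j, hj⟩ := hvar (ts 1)
      refine ⟨_, _, he₂ i j, fun v a h => ?_, fun v a h => ?_⟩
      · rw [heR _ _ _ _ (h i) (h j)]
        change _ ↔ (ts 0).realize _ ≤ (ts 1).realize _
        rw [hi, hj]
        rfl
      · rw [heS _ _ _ _ (h i) (h j)]
        change _ ↔ (ts 0).realize _ ≤ (ts 1).realize _
        rw [hi, hj]
        rfl
    | imp φ ψ ih₁ ih₂ =>
      obtain ⟨P₁, Q₁, h₁, hP₁, hQ₁⟩ := ih₁
      obtain ⟨P₂, Q₂, h₂, hP₂, hQ₂⟩ := ih₂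
      refine ⟨_, _, h₁.imp h₂, fun v a h => ?_, fun v a h => ?_⟩
      · rw [hP₁ v a h, hP₂ v a h]; rfl
      · rw [hQ₁ v a h, hQ₂ v a h]; rfl
    | @all n φ ih =>
      obtain ⟨P, Q, h, hP, hQ⟩ := ih
      have hs : DefPair
          (fun v : Fin n ⊕ Unit → M => P (Fin.snoc (fun i => v (Sum.inl i)) (v (Sum.inr ()))))
          (fun v : Fin n ⊕ Unit → N => Q (Fin.snoc (fun i => v (Sum.inl i)) (v (Sum.inr ())))) := by
        refine h.subst (t := fun i v => Fin.snoc (α := fun _ => M) (fun i => v (Sum.inl i))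
          (v (Sum.inr ())) i) (s := fun i v => Fin.snoc (α := fun _ => N)
          (fun i => v (Sum.inl i)) (v (Sum.inr ())) i) fun i => ?_
        refine Fin.lastCases ?_ (fun i => ?_) i
        · simp only [Fin.snoc_last]; exact .var _
        · simp only [Fin.snoc_castSucc]; exact .var _
      have hd' : DefPair (fun v : Fin n ⊕ Unit → M => d (v (Sum.inr ())))
          (fun v : Fin n ⊕ Unit → N => d' (v (Sum.inr ()))) :=
        hd.subst (t := fun _ v => v (Sum.inr ())) (s := fun _ v => v (Sum.inr ())) fun _ => .var _
      refine ⟨fun v => ∀ x, d x → P (Fin.snoc v x), fun v => ∀ x, d' x → Q (Fin.snoc v x),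
        .all (hd'.imp hs), fun v a hv => ?_, fun v a hv => ?_⟩
      · rw [BoundedFormula.realize_all]
        have step : ∀ x c, R x c → (P (Fin.snoc v x) ↔ φ.Realize default (Fin.snoc a c)) :=
          fun x c hc => hP _ _ fun i => by
            refine Fin.lastCases ?_ (fun i => ?_) i
            · simpa only [Fin.snoc_last] using hc
            · simpa only [Fin.snoc_castSucc] using hv i
        constructor
        · intro H c
          obtain ⟨x, hx⟩ := hR c
          exact (step x c hx).1 (H x ((hdR x).2 ⟨c, hx⟩))
        · intro H x hx
          obtain ⟨c, hc⟩ := (hdR x).1 hx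
          exact (step x c hc).2 (H c)
      · rw [BoundedFormula.realize_all]
        have step : ∀ x c, S x c → (Q (Fin.snoc v x) ↔ φ.Realize default (Fin.snoc a c)) :=
          fun x c hc => hQ _ _ fun i => by
            refine Fin.lastCases ?_ (fun i => ?_) i
            · simpa only [Fin.snoc_last] using hc
            · simpa only [Fin.snoc_castSucc] using hv i
        constructor
        · intro H c
          obtain ⟨x, hx⟩ := hS c
          exact (step x c hx).1 (H x ((hdS x).2 ⟨c, hx⟩))
        · intro H x hx
          obtain ⟨c, hc⟩ := (hdS x).1 hx
          exact (step x c hc).2 (H c)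
  refine elementarilyEquivalent_iff.2 fun φ => ?_
  obtain ⟨P, Q, h, hP, hQ⟩ := key φ
  have hiff : P finZeroElim ↔ Q finZeroElim :=
    DefPair.iff_of_elemEquiv hMN
      ((h.subst (α := Empty) (t := finZeroElim) (s := finZeroElim) fun i => i.elim0).congr
        (fun v => iff_of_eq (congrArg P (funext fun i => i.elim0)))
        (fun v => iff_of_eq (congrArg Q (funext fun i => i.elim0))))
  rw [hP finZeroElim default fun i => i.elim0, hQ finZeroElim default fun i => i.elim0] at hiff
  exact hiff

end Definability

/-! ### Polars and the formulas that describe the root system -/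

section Formulas

variable {M N : Type*} [Group M] [Lattice M] [Group N] [Lattice N] {α : Type}

/-- Orthogonality in an `ℓ`-group: `|x| ∧ |y| = 1`. -/
def Perp (x y : M) : Prop := (x ⊔ x⁻¹) ⊓ (y ⊔ y⁻¹) = 1

/-- `y` lies in the double polar of the set of conjugates of `g` that are not orthogonal to `g`. -/
def InHull (g y : M) : Prop :=
  ∀ z, (∀ h, ¬ Perp (h * g * h⁻¹) g → Perp (h * g * h⁻¹) z) → Perp y z

/-- Inclusion of hulls. -/
def HullLE (p q : M) : Prop := ∀ y, InHull p y → InHull q y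

/-- The hull of `g` is nontrivial, meets no conjugate other than itself, and no two of its
nontrivial normal subgroups are orthogonal. -/
def IsBlockParam (g : M) : Prop :=
  (∃ b, InHull g b ∧ b ≠ 1) ∧
  (∀ h b, InHull g b → b ≠ 1 → InHull g (h * b * h⁻¹) →
    ∀ c, InHull g c → InHull g (h * c * h⁻¹)) ∧
  ∀ x, InHull g x → x ≠ 1 → ∀ y, InHull g y → y ≠ 1 →
    ∃ b, InHull g b ∧ ¬ Perp (b * x * b⁻¹) y

/-- The hulls properly inside the hull of `g` do not exist, or are not upwards directed. -/
def IsRootParam (g : M) : Prop :=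
  IsBlockParam g ∧ ((∀ p, IsBlockParam p → HullLE p g → HullLE g p) ∨
    ∃ p q, IsBlockParam p ∧ IsBlockParam q ∧ HullLE p g ∧ HullLE q g ∧ ¬ HullLE g p ∧
      ¬ HullLE g q ∧ ∀ r, IsBlockParam r → HullLE p r → HullLE q r → HullLE r g → HullLE g r)

/-- Some conjugate of the hull of `p` lies in the hull of `q`. -/
def ConjHullLE (p q : M) : Prop := ∃ h, ∀ y, InHull p y → InHull q (h * y * h⁻¹)

/-- `k` normalizes the hull of `g`. -/
def StabilizesHull (g k : M) : Prop := ∀ y, InHull g y ↔ InHull g (k * y * k⁻¹)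

/-- `p` describes an element of the root system properly inside the one described by `g`. -/
def IsRootParamBelow (g p : M) : Prop := IsRootParam p ∧ HullLE p g ∧ ¬ HullLE g p

/-- `k` acts trivially on the o-primitive component described by `g`. -/
def TrivialOnHull (g k : M) : Prop :=
  (∀ y, InHull g y → Perp k y) ∨
    ((∃ p, IsRootParamBelow g p) ∧ ∀ p, IsRootParamBelow g p →
      ∃ q, IsRootParamBelow g q ∧ HullLE p q ∧ ∀ y, InHull p y → InHull q (k * y * k⁻¹))

/-- The o-primitive component described by `g` has irreducible elements. -/
def HasIrreducibleOnHull (g : M) : Prop :=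
  ∃ k, StabilizesHull g k ∧ 1 ≤ k ∧ ¬ TrivialOnHull g k ∧
    ∀ k₁ k₂, StabilizesHull g k₁ → StabilizesHull g k₂ → TrivialOnHull g (k⁻¹ * (k₁ ⊔ k₂)) →
      TrivialOnHull g (k₁ ⊓ k₂) → TrivialOnHull g k₁ ∨ TrivialOnHull g k₂

/-! ### Uniform definability of the formulas about hulls -/

namespace DefPair

variable {t t' : (α → M) → M} {s s' : (α → N) → N}

theorem perp (h : TermPair t s) (h' : TermPair t' s') :
    DefPair (fun v => Perp (t v) (t' v)) (fun v => Perp (s v) (s' v)) :=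
  .eq ((h.sup h.inv).inf (h'.sup h'.inv)) .one

/-- The proof terms from here on retrace the syntax of the definitions: each quantifier adds one
`weaken` to the parameters, and `.last` is the innermost bound variable. -/
theorem inHull (h : TermPair t s) (h' : TermPair t' s') :
    DefPair (fun v => InHull (t v) (t' v)) (fun v => InHull (s v) (s' v)) :=
  .all (.imp (.all (.imp (.not (.perp (.conj .last h.weaken.weaken) h.weaken.weaken))
    (.perp (.conj .last h.weaken.weaken) (.var _)))) (.perp h'.weaken .last))

theorem hullLE (h : TermPair t s) (h' : TermPair t' s') :
    DefPair (fun v => HullLE (t v) (t' v)) (fun v => HullLE (s v) (s' v)) :=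
  .all (.imp (.inHull h.weaken .last) (.inHull h'.weaken .last))

theorem isBlockParam (h : TermPair t s) :
    DefPair (fun v => IsBlockParam (t v)) (fun v => IsBlockParam (s v)) :=
  .and (.ex (.and (.inHull h.weaken .last) (.ne .last .one)))
    (.and
      (.all (.all (.imp (.inHull h.weaken.weaken .last) (.imp (.ne .last .one)
        (.imp (.inHull h.weaken.weaken (.conj (.var _) .last))
          (.all (.imp (.inHull h.weaken.weaken.weaken .last)
            (.inHull h.weaken.weaken.weaken (.conj (.var _) .last)))))))))
      (.all (.imp (.inHull h.weaken .last) (.imp (.ne .last .one)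
        (.all (.imp (.inHull h.weaken.weaken .last) (.imp (.ne .last .one)
          (.ex (.and (.inHull h.weaken.weaken.weaken .last)
            (.not (.perp (.conj .last (.var _)) (.var _))))))))))))

theorem isRootParam (h : TermPair t s) :
    DefPair (fun v => IsRootParam (t v)) (fun v => IsRootParam (s v)) :=
  .and (.isBlockParam h) (.or
    (.all (.imp (.isBlockParam .last) (.imp (.hullLE .last h.weaken) (.hullLE h.weaken .last))))
    (.ex (.ex (.and (.isBlockParam (.var _)) (.and (.isBlockParam .last)
      (.and (.hullLE (.var _) h.weaken.weaken) (.and (.hullLE .last h.weaken.weaken)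
        (.and (.not (.hullLE h.weaken.weaken (.var _))) (.and (.not (.hullLE h.weaken.weaken .last))
        (.all (.imp (.isBlockParam .last) (.imp (.hullLE (.var _) .last)
          (.imp (.hullLE (.var _) .last) (.imp (.hullLE .last h.weaken.weaken.weaken)
            (.hullLE h.weaken.weaken.weaken .last)))))))))))))))

theorem conjHullLE (h : TermPair t s) (h' : TermPair t' s') :
    DefPair (fun v => ConjHullLE (t v) (t' v)) (fun v => ConjHullLE (s v) (s' v)) :=
  .ex (.all (.imp (.inHull h.weaken.weaken .last)
    (.inHull h'.weaken.weaken (.conj (.var _) .last))))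

theorem stabilizesHull (h : TermPair t s) (h' : TermPair t' s') :
    DefPair (fun v => StabilizesHull (t v) (t' v)) (fun v => StabilizesHull (s v) (s' v)) :=
  .all (.iff (.inHull h.weaken .last) (.inHull h.weaken (.conj h'.weaken .last)))

theorem isRootParamBelow (h : TermPair t s) (h' : TermPair t' s') :
    DefPair (fun v => IsRootParamBelow (t v) (t' v)) (fun v => IsRootParamBelow (s v) (s' v)) :=
  .and (.isRootParam h') (.and (.hullLE h' h) (.not (.hullLE h h')))

theorem trivialOnHull (h : TermPair t s) (h' : TermPair t' s') :
    DefPair (fun v => TrivialOnHull (t v) (t' v)) (fun v => TrivialOnHull (s v) (s' v)) :=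
  .or (.all (.imp (.inHull h.weaken .last) (.perp h'.weaken .last)))
    (.and (.ex (.isRootParamBelow h.weaken .last))
      (.all (.imp (.isRootParamBelow h.weaken .last)
        (.ex (.and (.isRootParamBelow h.weaken.weaken .last) (.and (.hullLE (.var _) .last)
          (.all (.imp (.inHull (.var _) .last)
            (.inHull (.var _) (.conj h'.weaken.weaken.weaken .last))))))))))

theorem hasIrreducibleOnHull (h : TermPair t s) :
    DefPair (fun v => HasIrreducibleOnHull (t v)) (fun v => HasIrreducibleOnHull (s v)) :=
  .ex (.and (.stabilizesHull h.weaken .last) (.and (.le .one .last)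
    (.and (.not (.trivialOnHull h.weaken .last))
      (.all (.all (.imp (.stabilizesHull h.weaken.weaken.weaken (.var _))
        (.imp (.stabilizesHull h.weaken.weaken.weaken .last)
          (.imp (.trivialOnHull h.weaken.weaken.weaken (.mul (.inv (.var _)) (.sup (.var _) .last)))
            (.imp (.trivialOnHull h.weaken.weaken.weaken (.inf (.var _) .last))
              (.or (.trivialOnHull h.weaken.weaken.weaken (.var _))
                (.trivialOnHull h.weaken.weaken.weaken .last)))))))))))

end DefPair

end Formulas

/-! ### Pointwise computations in an `ℓ`-permutation group -/

namespace LPermGroup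

section Pointwise

variable {Ω : Type*} [LinearOrder Ω] {G : LPermGroup Ω}

theorem inv_apply_self (g : G.toSubgroup) (x : Ω) : (g⁻¹).1 (g.1 x) = x :=
  RelIso.inv_apply_self g.1 x

theorem apply_inv_self (g : G.toSubgroup) (x : Ω) : g.1 ((g⁻¹).1 x) = x :=
  RelIso.apply_inv_self g.1 x

theorem sup_apply (f g : G.toSubgroup) (x : Ω) : (f ⊔ g).1 x = max (f.1 x) (g.1 x) := rfl

theorem inf_apply (f g : G.toSubgroup) (x : Ω) : (f ⊓ g).1 x = min (f.1 x) (g.1 x) := rfl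

theorem eq_iff_forall_apply {f g : G.toSubgroup} : f = g ↔ ∀ x, f.1 x = g.1 x :=
  ⟨fun h _ => h ▸ rfl, fun h => Subtype.ext (RelIso.ext h)⟩

theorem exists_apply_ne {g : G.toSubgroup} (h : g ≠ 1) : ∃ x, g.1 x ≠ x := by
  by_contra! H
  exact h (eq_iff_forall_apply.2 H)

theorem inv_apply_eq_of_apply_eq {g : G.toSubgroup} {x : Ω} (h : g.1 x = x) :
    (g⁻¹).1 x = x := by
  conv_lhs => rw [← h]
  exact inv_apply_self g x

theorem lt_sup_inv_apply {g : G.toSubgroup} {x : Ω} (h : g.1 x ≠ x) : x < (g ⊔ g⁻¹).1 x := by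
  rw [sup_apply]
  rcases lt_or_gt_of_ne h with h | h
  · refine lt_max_of_lt_right ?_
    have := (g⁻¹).1.strictMono h
    rwa [inv_apply_self] at this
  · exact lt_max_of_lt_left h

theorem sup_inv_apply_eq {g : G.toSubgroup} {x : Ω} (h : g.1 x = x) : (g ⊔ g⁻¹).1 x = x := by
  rw [sup_apply, h, inv_apply_eq_of_apply_eq h, max_self]

/-- The element |f| moves a point strictly upwards where f moves it and fixes it elsewhere, so |f| ∧
|g| = 1 means disjoint supports. -/
theorem perp_iff {f g : G.toSubgroup} : Perp f g ↔ ∀ x, f.1 x = x ∨ g.1 x = x := by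
  rw [Perp, eq_iff_forall_apply]
  refine forall_congr' fun x => ?_
  rw [inf_apply]
  constructor
  · intro h
    by_contra! H
    exact absurd h (lt_min (lt_sup_inv_apply H.1) (lt_sup_inv_apply H.2)).ne'
  · have le : ∀ k : G.toSubgroup, x ≤ (k ⊔ k⁻¹).1 x := fun k => by
      by_cases hk : k.1 x = x
      · exact (sup_inv_apply_eq hk).ge
      · exact (lt_sup_inv_apply hk).le
    rintro (h | h)
    · rw [sup_inv_apply_eq h]; exact min_eq_left (le g)
    · rw [sup_inv_apply_eq h]; exact min_eq_right (le f)

theorem conj_apply_ne_iff (h g : G.toSubgroup) (x : Ω) :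
    (h * g * h⁻¹).1 x ≠ x ↔ g.1 ((h⁻¹).1 x) ≠ (h⁻¹).1 x := by
  refine not_congr ⟨fun H => ?_, fun H => ?_⟩
  · have := congrArg (h⁻¹).1 H
    exact (inv_apply_self h _).symm.trans this
  · exact (congrArg h.1 H).trans (apply_inv_self h x)

theorem conj_apply_apply_ne_iff (h g : G.toSubgroup) (x : Ω) :
    (h * g * h⁻¹).1 (h.1 x) ≠ h.1 x ↔ g.1 x ≠ x := by
  rw [conj_apply_ne_iff, inv_apply_self]

/-- An automorphism that moves `u` moves every point between `u` and its image. -/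
theorem apply_ne_of_mem_uIcc {g : G.toSubgroup} {u w : Ω} (hu : g.1 u ≠ u)
    (hw : w ∈ Set.uIcc u (g.1 u)) : g.1 w ≠ w := by
  intro h
  have key : w ≠ g.1 u := fun e => hu (g.1.injective (by rw [← e, h]))
  rcases lt_or_gt_of_ne hu with hlt | hlt
  · rw [Set.uIcc_of_ge hlt.le] at hw
    exact key (le_antisymm (h ▸ g.1.monotone hw.2) hw.1)
  · rw [Set.uIcc_of_le hlt.le] at hw
    exact key (le_antisymm hw.2 (h ▸ g.1.monotone hw.1))

end Pointwise

/-! ### Transitive o-primitive groups -/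

section Primitive

variable {X : Type*} [LinearOrder X] {P : LPermGroup X}

/-- In an o-primitive group the images of a proper cut separate points. -/
theorem exists_separating_image
    (prim : ∀ E : ConvexCongruence P, (∀ x y, E.toSetoid x y → x = y) ∨ ∀ x y, E.toSetoid x y)
    {S : Set X} (hS : IsLowerSet S) {a b : X} (ha : a ∈ S) (hb : b ∉ S) {x y : X} (hxy : x < y) :
    ∃ w : P.toSubgroup, w.1 x ∈ S ∧ w.1 y ∉ S := by
  -- Points are related when no image of the cut separates them. Primitivity makes E trivial or
  -- universal, and it is not universal because S itself separates a from b.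
  let E : ConvexCongruence P :=
    { r := fun x y => ∀ w : P.toSubgroup, w.1 x ∈ S ↔ w.1 y ∈ S
      iseqv := ⟨fun _ _ => Iff.rfl, fun h w => (h w).symm, fun h h' w => (h w).trans (h' w)⟩
      map' := fun g hg _ _ h w => h (w * (⟨g, hg⟩ : P.toSubgroup))
      convex' := fun c => ⟨fun u hu v hv z hz w =>
        ⟨fun h => hS (w.1.monotone hz.2) ((hv w).1 h),
          fun h => (hu w).2 (hS (w.1.monotone hz.1) h)⟩⟩ }
  rcases prim E with h | h
  · by_contra! H
    exact hxy.ne (h x y fun w => ⟨H w, fun hy => hS (w.1.monotone hxy.le) hy⟩)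
  · exact absurd ((h a b 1).1 ha) hb

/-- If no positive element of a transitive o-primitive group has a bump that is the whole of `X`,
then the points to the right of a point can be moved arbitrarily far without raising that point. -/
theorem exists_reaching (hP : P.IsTransitive)
    (prim : ∀ E : ConvexCongruence P, (∀ x y, E.toSetoid x y → x = y) ∨ ∀ x y, E.toSetoid x y)
    (hbump : ∀ f : P.toSubgroup, 1 ≤ f → ∃ x y, ∀ n : ℕ, (f ^ n).1 y < x)
    {a b : X} (hab : a < b) (z : X) : ∃ w : P.toSubgroup, w.1 a ≤ a ∧ z ≤ w.1 b := by
  obtain ⟨g₀, hg₀, hz⟩ := hP a z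
  let g : P.toSubgroup := ⟨g₀, hg₀⟩ ⊔ 1
  have hg : 1 ≤ g := le_sup_right
  have hga : z ≤ g.1 a := hz ▸ le_max_left (g₀ a) a
  obtain ⟨x, y, hxy⟩ := hbump g hg
  -- If the forward orbit of a is bounded, cut at its supremum and pull back by a power of g.
  -- Otherwise the orbit of y never reaches g a, and the cut consists of the points whose forward
  -- orbits stay below g a.
  by_cases hS : ∃ c, ∀ n : ℕ, (g ^ n).1 a < c
  · obtain ⟨c, hc⟩ := hS
    obtain ⟨w, ⟨n, hn⟩, hw⟩ := exists_separating_image prim (S := {y | ∃ n : ℕ, y ≤ (g ^ n).1 a})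
      (fun u v huv ⟨n, hn⟩ => ⟨n, huv.trans hn⟩) (a := a) (b := c) ⟨0, le_rfl⟩
      (fun ⟨n, hn⟩ => (hc n).not_ge hn) hab
    refine ⟨(g ^ n)⁻¹ * w, ?_, ?_⟩
    · have := ((g ^ n)⁻¹).1.monotone hn
      rwa [inv_apply_self] at this
    · have h₁ : (g ^ (n + 1)).1 a ≤ w.1 b := le_of_not_ge fun h => hw ⟨n + 1, h⟩
      have h₂ := ((g ^ n)⁻¹).1.monotone h₁
      rw [pow_succ] at h₂
      exact hga.trans ((inv_apply_self (g ^ n) (g.1 a)).symm.trans_le h₂)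
  · have hy : ∀ n : ℕ, (g ^ n).1 y < g.1 a := by
      intro n
      by_contra! h
      apply hS
      refine ⟨x, fun m => lt_of_le_of_lt ?_ (hxy (m + n))⟩
      rw [pow_add]
      exact (g ^ m).1.monotone ((hg a).trans h)
    obtain ⟨w, hw₁, hw₂⟩ := exists_separating_image prim
      (S := {y | ∀ n : ℕ, (g ^ n).1 y < g.1 a})
      (fun u v huv h n => ((g ^ n).1.monotone huv).trans_lt (h n)) (a := y) (b := a) hy
      (fun h => lt_irrefl (g.1 a) (by simpa using h 1)) hab
    obtain ⟨n, hn⟩ := not_forall.1 hw₂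
    refine ⟨g ^ n * w, ?_, hga.trans (not_lt.1 hn)⟩
    -- The cut was taken at g a rather than at a, so one factor g can be cancelled to leave (g ^ n *
    -- w) a < a.
    have h := hw₁ (n + 1)
    rw [pow_succ'] at h
    exact (g.1.lt_iff_lt.1 h).le

/-- A transitive o-primitive group is o-2 transitive, or it has a positive element with a single
bump that is the whole of `X`. -/
theorem isO2Transitive_or_exists_bump (hP : P.IsTransitive)
    (prim : ∀ E : ConvexCongruence P, (∀ x y, E.toSetoid x y → x = y) ∨ ∀ x y, E.toSetoid x y) :
    P.IsO2Transitive ∨ ∃ f : P.toSubgroup, 1 ≤ f ∧ ∀ x y, ∃ n : ℕ, x ≤ (f ^ n).1 y := by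
  refine or_iff_not_imp_right.2 fun hbump => ?_
  push Not at hbump
  intro α β α' β' h h'
  obtain ⟨a₀, ha₀, ha⟩ := hP α α'
  obtain ⟨b₀, hb₀, hb⟩ := hP β β'
  obtain ⟨a, rfl⟩ : ∃ a : P.toSubgroup, a.1 = a₀ := ⟨⟨a₀, ha₀⟩, rfl⟩
  obtain ⟨b, rfl⟩ : ∃ b : P.toSubgroup, b.1 = b₀ := ⟨⟨b₀, hb₀⟩, rfl⟩
  obtain ⟨w, hw₁, hw₂⟩ := exists_reaching hP prim hbump h ((a⁻¹).1 β')
  obtain ⟨v, hv₁, hv₂⟩ := exists_reaching hP prim hbump h' (a.1 β)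
  have p₁ : (a * w).1 α ≤ α' := ha ▸ a.1.monotone hw₁
  have p₂ : β' ≤ (a * w).1 β := (apply_inv_self a β').symm.trans_le (a.1.monotone hw₂)
  have q₁ : α' ≤ (v⁻¹ * a).1 α := by
    have := (v⁻¹).1.monotone hv₁
    rw [inv_apply_self] at this
    exact this.trans_eq (congrArg _ ha.symm)
  have q₂ : (v⁻¹ * a).1 β ≤ β' := by
    have := (v⁻¹).1.monotone hv₂
    rwa [inv_apply_self] at this
  -- Near α the element should behave like a, near β like b. The first meet is at most α' at α and
  -- equals β' at β; the second equals α' at α and is at most β' at β.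
  refine ⟨(b ⊓ (a * w ⊔ a) ⊔ v⁻¹ * a ⊓ a).1, Subtype.property _, ?_, ?_⟩
  · rw [sup_apply, inf_apply, inf_apply, sup_apply, ha, max_eq_right p₁, min_eq_right q₁]
    exact max_eq_right (min_le_right _ _)
  · rw [sup_apply, inf_apply, inf_apply, sup_apply, hb, min_eq_left (p₂.trans (le_max_left _ _))]
    exact max_eq_left ((min_le_left _ _).trans q₂)

/-- If f were a join of disjoint f₁, f₂ moving x < y respectively, then f would act as f₁ along the
forward orbit of x. Since f₁ fixes y, that orbit would stay below y, against the single bump. -/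
theorem isIrreducibleElement_of_bump {f : P.toSubgroup} (hf : 1 ≤ f)
    (hbump : ∀ x y, ∃ n : ℕ, x ≤ (f ^ n).1 y) {x₀ y₀ : X} (h₀ : x₀ < y₀) :
    IsIrreducibleElement f := by
  refine ⟨lt_of_le_of_ne hf ?_, ?_⟩
  · rintro rfl
    obtain ⟨n, hn⟩ := hbump y₀ x₀
    rw [one_pow] at hn
    exact h₀.not_ge hn
  · have key : ∀ f₁ f₂ : P.toSubgroup, f₁ ⊔ f₂ = f → f₁ ⊓ f₂ = 1 → ∀ x y, x < y →
        f₁.1 x ≠ x → f₂.1 y ≠ y → False := by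
      intro f₁ f₂ hs hi x y hxy hx hy
      have fix : ∀ z, f₁.1 z ≠ z → f₂.1 z = z := fun z hz => by
        have := eq_iff_forall_apply.1 hi z
        rw [inf_apply] at this
        rcases min_choice (f₁.1 z) (f₂.1 z) with e | e
        · exact absurd (e.symm.trans this) hz
        · exact e.symm.trans this
      have hfy : f₁.1 y = y := not_not.1 fun h => hy (fix y h)
      have step : ∀ n : ℕ, f₁.1 ((f ^ n).1 x) ≠ (f ^ n).1 x ∧ (f ^ n).1 x < y := by
        intro n
        induction n with
        | zero => exact ⟨hx, hxy⟩
        | succ n ih =>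
          have e : (f ^ (n + 1)).1 x = f₁.1 ((f ^ n).1 x) := by
            have h₁ := eq_iff_forall_apply.1 hs ((f ^ n).1 x)
            have h₂ := eq_iff_forall_apply.1 hi ((f ^ n).1 x)
            rw [pow_succ']
            refine h₁.symm.trans ?_
            rw [sup_apply, fix _ ih.1]
            rw [inf_apply, fix _ ih.1] at h₂
            exact max_eq_left (min_eq_right_iff.1 h₂)
          rw [e]
          exact ⟨fun h => ih.1 (f₁.1.injective h), hfy ▸ f₁.1.strictMono ih.2⟩
      obtain ⟨n, hn⟩ := hbump y x
      exact hn.not_gt (step n).2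
    intro f₁ f₂ hs hi
    by_contra! H
    obtain ⟨x, hx⟩ := exists_apply_ne H.1
    obtain ⟨y, hy⟩ := exists_apply_ne H.2
    rcases lt_trichotomy x y with h | rfl | h
    · exact key f₁ f₂ hs hi x y h hx hy
    · have := eq_iff_forall_apply.1 hi x
      rw [inf_apply] at this
      rcases min_choice (f₁.1 x) (f₂.1 x) with e | e
      · exact hx (e.symm.trans this)
      · exact hy (e.symm.trans this)
    · exact key f₂ f₁ (sup_comm f₁ f₂ ▸ hs) (inf_comm f₁ f₂ ▸ hi) y x h hy hx

end Primitive

end LPermGroup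

/-! ### Convex congruences of a transitive group -/

namespace ConvexCongruence

variable {Ω : Type*} [LinearOrder Ω] {G : LPermGroup Ω} {C D E : ConvexCongruence G} {a b c : Ω}

theorem le_iff : C ≤ D ↔ ∀ a b, C.toSetoid a b → D.toSetoid a b :=
  ⟨fun h _ _ => @h _ _, fun h _ _ => h _ _⟩

theorem rel_of_mem_Icc (h : C.toSetoid a c) (hb : b ∈ Set.Icc a c) : C.toSetoid a b :=
  (C.convex' a).out (C.toSetoid.refl' a) h hb

theorem rel_of_mem_Icc' (h : C.toSetoid c a) (hb : b ∈ Set.Icc a c) : C.toSetoid c b :=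
  (C.convex' c).out h (C.toSetoid.refl' c) hb

theorem apply_rel_iff (g : G.toSubgroup) : C.toSetoid (g.1 a) (g.1 b) ↔ C.toSetoid a b := by
  refine ⟨fun h => ?_, C.map' g.1 g.2 a b⟩
  have := C.map' (g⁻¹).1 (g⁻¹).2 _ _ h
  rwa [LPermGroup.inv_apply_self, LPermGroup.inv_apply_self] at this

theorem mem_block_self : a ∈ C.block a := C.toSetoid.refl' a

theorem block_eq (h : C.toSetoid a b) : C.block a = C.block b :=
  Set.ext fun _ => ⟨fun h' => C.toSetoid.trans' (C.toSetoid.symm' h) h',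
    fun h' => C.toSetoid.trans' h h'⟩

theorem block_mono (h : C ≤ D) : C.block a ⊆ D.block a := fun b hb => le_iff.1 h a b hb

theorem apply_mem_block_iff (g : G.toSubgroup) : g.1 b ∈ C.block (g.1 a) ↔ b ∈ C.block a :=
  apply_rel_iff g

/-- G permutes the blocks of C, so one point of a block that stays in it forces the whole block to
be stabilized. -/
theorem apply_mem_block_iff_of_rel {g : G.toSubgroup} {x : Ω} (hx : x ∈ C.block a)
    (hgx : g.1 x ∈ C.block a) : g.1 b ∈ C.block a ↔ b ∈ C.block a := by
  rw [block_eq hgx, apply_mem_block_iff, ← block_eq hx, ← block_eq hgx]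

/-- The convex congruences of a transitive `ℓ`-permutation group are totally ordered. -/
protected theorem le_total (hG : G.IsTransitive) (C D : ConvexCongruence G) : C ≤ D ∨ D ≤ C := by
  by_contra! H
  obtain ⟨H₁, H₂⟩ := H
  rw [le_iff] at H₁ H₂
  push Not at H₁ H₂
  -- By transitivity a witness of non-inclusion can start at any prescribed point and go upwards.
  -- Two witnesses starting at the same point are then compared by convexity.
  have norm : ∀ C D : ConvexCongruence G, ∀ a b, C.toSetoid a b → ¬ D.toSetoid a b →
      ∀ c, ∃ d, c < d ∧ C.toSetoid c d ∧ ¬ D.toSetoid c d := by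
    intro C D a b h h' c
    wlog hab : a < b generalizing a b
    · refine this b a (C.toSetoid.symm' h) (fun h₁ => h' (D.toSetoid.symm' h₁)) ?_
      refine lt_of_le_of_ne (not_lt.1 hab) ?_
      rintro rfl
      exact h' (D.toSetoid.refl' _)
    · obtain ⟨g, hg, rfl⟩ := hG a c
      exact ⟨g b, g.strictMono hab, C.map' g hg _ _ h, fun h₁ => h' ((apply_rel_iff ⟨g, hg⟩).1 h₁)⟩
  obtain ⟨a, b, h, h'⟩ := H₁
  obtain ⟨_, _, k, k'⟩ := H₂
  obtain ⟨d, hd, h₁, h₂⟩ := norm C D _ _ h h' a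
  obtain ⟨e, he, k₁, k₂⟩ := norm D C _ _ k k' a
  rcases le_total d e with hde | hde
  · exact h₂ (rel_of_mem_Icc k₁ ⟨hd.le, hde⟩)
  · exact k₂ (rel_of_mem_Icc h₁ ⟨he.le, hde⟩)

theorem le_of_not_le (hG : G.IsTransitive) (h : ¬ C ≤ D) : D ≤ C :=
  (ConvexCongruence.le_total hG C D).resolve_left h

theorem block_subset_block_iff (hG : G.IsTransitive) : C.block a ⊆ D.block a ↔ C ≤ D := by
  refine ⟨fun h => le_iff.2 fun x y hxy => ?_, block_mono⟩
  obtain ⟨g, hg, rfl⟩ := hG x a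
  exact (apply_rel_iff ⟨g, hg⟩).1 (h ((apply_rel_iff ⟨g, hg⟩).2 hxy))

theorem block_subset_block_iff' (hG : G.IsTransitive) :
    C.block a ⊆ D.block b ↔ D.toSetoid b a ∧ C ≤ D := by
  constructor
  · intro h
    have hba : D.toSetoid b a := h mem_block_self
    rw [block_eq hba] at h
    exact ⟨hba, (block_subset_block_iff hG).1 h⟩
  · rintro ⟨h₁, h₂⟩
    rw [block_eq h₁]
    exact block_mono h₂

end ConvexCongruence

namespace LPermGroup

open ConvexCongruence

/-! ### The spine of a transitive group and elements supported on a block -/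

section Transitive

variable {Ω : Type*} [LinearOrder Ω] {G : LPermGroup Ω} {C D E : ConvexCongruence G} {a b : Ω}

theorem V_rel (a b : Ω) : (G.V a b).toSetoid a b := fun _ h => h

theorem V_le_iff : G.V a b ≤ C ↔ C.toSetoid a b :=
  ⟨fun h => le_iff.1 h a b (V_rel a b), fun h => le_iff.2 fun _ _ h' => h' C h⟩

theorem V_mem_spine (h : a ≠ b) : G.V a b ∈ G.spine := ⟨a, b, h, rfl⟩

/-- Every member of the spine covers a convex congruence. -/
theorem exists_covBy (hG : G.IsTransitive) (hC : C ∈ G.spine) : ∃ D, D ⋖ C := by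
  obtain ⟨a, b, hab, rfl⟩ := hC
  -- The union of all convex congruences that do not relate a and b; it is transitive and convex
  -- because the congruences form a chain.
  let D : ConvexCongruence G :=
    { r := fun x y => x = y ∨ ∃ E : ConvexCongruence G, ¬ E.toSetoid a b ∧ E.toSetoid x y
      iseqv :=
        { refl := fun _ => Or.inl rfl
          symm := by
            rintro x y (rfl | ⟨E, h, h'⟩)
            · exact Or.inl rfl
            · exact Or.inr ⟨E, h, E.toSetoid.symm' h'⟩
          trans := by
            rintro x y z (rfl | ⟨E, h, h'⟩) (rfl | ⟨F, k, k'⟩)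
            · exact Or.inl rfl
            · exact Or.inr ⟨F, k, k'⟩
            · exact Or.inr ⟨E, h, h'⟩
            · rcases ConvexCongruence.le_total hG E F with hl | hl
              · exact Or.inr ⟨F, k, F.toSetoid.trans' (le_iff.1 hl _ _ h') k'⟩
              · exact Or.inr ⟨E, h, E.toSetoid.trans' h' (le_iff.1 hl _ _ k')⟩ }
      map' := by
        rintro g hg x y (rfl | ⟨E, h, h'⟩)
        · exact Or.inl rfl
        · exact Or.inr ⟨E, h, E.map' g hg _ _ h'⟩
      convex' := by
        refine fun c => ⟨?_⟩
        rintro u (rfl | ⟨E, h, h'⟩) v (rfl | ⟨F, k, k'⟩) z hz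
        · exact Or.inl (le_antisymm hz.1 hz.2)
        · exact Or.inr ⟨F, k, rel_of_mem_Icc k' hz⟩
        · exact Or.inr ⟨E, h, rel_of_mem_Icc' h' hz⟩
        · rcases ConvexCongruence.le_total hG E F with hl | hl
          · exact Or.inr ⟨F, k, (F.convex' c).out (le_iff.1 hl _ _ h') k' hz⟩
          · exact Or.inr ⟨E, h, (E.convex' c).out h' (le_iff.1 hl _ _ k') hz⟩ }
  have hD : ¬ D.toSetoid a b := by
    rintro (h | ⟨E, h, h'⟩)
    · exact hab h
    · exact h h'
  have hDV : D ≤ G.V a b :=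
    le_of_not_le hG fun h => hD (V_le_iff.1 h)
  refine ⟨D, lt_of_le_not_ge hDV fun h => hD (V_le_iff.1 h), fun E h₁ h₂ => h₁.not_ge ?_⟩
  refine le_iff.2 fun x y hxy => Or.inr ⟨E, fun h => h₂.not_ge (V_le_iff.2 h), hxy⟩

theorem V_eq_of_covBy (hG : G.IsTransitive) (hDC : D ⋖ C) (h : C.toSetoid a b)
    (h' : ¬ D.toSetoid a b) : G.V a b = C := by
  have h₁ : G.V a b ≤ C := V_le_iff.2 h
  have h₂ : ¬ G.V a b ≤ D := fun h => h' (V_le_iff.1 h)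
  have h₃ : D < G.V a b := lt_of_le_not_ge (le_of_not_le hG h₂) h₂
  exact h₁.eq_of_not_lt fun h => hDC.2 h₃ h

theorem le_of_covBy (hG : G.IsTransitive) (hDC : D ⋖ C) (h : E < C) : E ≤ D := by
  by_contra h'
  exact hDC.2 (lt_of_le_not_ge (le_of_not_le hG h') h') h

theorem exists_rel_not_rel_of_covBy (hDC : D ⋖ C) : ∃ a b, C.toSetoid a b ∧ ¬ D.toSetoid a b := by
  have := hDC.lt.not_ge
  rw [le_iff] at this
  push Not at this
  exact this

theorem exists_ne_rel (hG : G.IsTransitive) (h : a ≠ b) (hab : C.toSetoid a b) (x : Ω) :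
    ∃ y, x ≠ y ∧ C.toSetoid x y := by
  obtain ⟨g, hg, rfl⟩ := hG a x
  exact ⟨g b, fun e => h (g.injective e), C.map' g hg _ _ hab⟩

/-- `g` is the identity off `A`. -/
def IsSupportedOn (A : Set Ω) (g : G.toSubgroup) : Prop := ∀ x, x ∉ A → g.1 x = x

theorem IsSupportedOn.mono {A B : Set Ω} {g : G.toSubgroup} (h : IsSupportedOn A g) (hAB : A ⊆ B) :
    IsSupportedOn B g := fun x hx => h x fun h' => hx (hAB h')

theorem IsSupportedOn.mem {A : Set Ω} {g : G.toSubgroup} (h : IsSupportedOn A g) {x : Ω}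
    (hx : g.1 x ≠ x) : x ∈ A := not_not.1 fun h' => hx (h x h')

theorem IsSupportedOn.conj {g : G.toSubgroup} (h : G.toSubgroup)
    (hg : IsSupportedOn (C.block a) g) : IsSupportedOn (C.block (h.1 a)) (h * g * h⁻¹) := by
  intro x hx
  by_contra H
  have := hg.mem ((conj_apply_ne_iff h g x).1 H)
  rw [← apply_mem_block_iff h, apply_inv_self] at this
  exact hx this

/-- In an abundant group an element that stabilizes `Δ ∈ T` can be restricted to `Δ`. -/
theorem IsAbundant.exists_restriction (hA : G.IsAbundant) (hC : C ∈ G.spine) {g : G.toSubgroup}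
    (hg : C.toSetoid a (g.1 a)) :
    ∃ d : G.toSubgroup, IsSupportedOn (C.block a) d ∧ ∀ x ∈ C.block a, d.1 x = g.1 x := by
  obtain ⟨d, hd, h₁, h₂⟩ := hA (C.block a) ⟨C, hC, a, rfl⟩ g.1
    ⟨g.2, fun x => apply_mem_block_iff_of_rel mem_block_self hg⟩
  exact ⟨⟨d, hd⟩, h₂, h₁⟩

theorem IsAbundant.exists_supported_apply_eq (hA : G.IsAbundant) (hG : G.IsTransitive)
    (hC : C ∈ G.spine) (h : C.toSetoid a b) :
    ∃ d : G.toSubgroup, IsSupportedOn (C.block a) d ∧ d.1 a = b := by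
  obtain ⟨g, hg, rfl⟩ := hG a b
  obtain ⟨d, hd, h'⟩ := hA.exists_restriction hC (g := ⟨g, hg⟩) h
  exact ⟨d, hd, h' a mem_block_self⟩

/-- Abundance restricts only to blocks of the spine, and E need not lie in it; the restriction is
made to a block of some V(x, y) ≤ E. -/
theorem IsAbundant.exists_supported_moving (hA : G.IsAbundant) (hG : G.IsTransitive)
    (hab : a ≠ b) (h : E.toSetoid a b) (x : Ω) :
    ∃ d : G.toSubgroup, IsSupportedOn (E.block x) d ∧ d.1 x ≠ x := by
  obtain ⟨y, hxy, hy⟩ := exists_ne_rel hG hab h x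
  obtain ⟨d, hd, rfl⟩ := hA.exists_supported_apply_eq hG (V_mem_spine hxy) (V_rel x y)
  exact ⟨d, hd.mono (block_mono (V_le_iff.2 hy)), hxy.symm⟩

theorem exists_ne_of_mem_spine (hC : C ∈ G.spine) : ∃ a b, a ≠ b ∧ C.toSetoid a b := by
  obtain ⟨a, b, h, rfl⟩ := hC
  exact ⟨a, b, h, V_rel a b⟩

end Transitive

/-! ### The o-primitive components -/

section Component

variable {Ω : Type*} [LinearOrder Ω] {G : LPermGroup Ω} {C D : ConvexCongruence G} {α : Ω}

theorem mk_lt_mk_iff {Δ : Set Ω} (x y : Δ) :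
    BlockQuotient.mk D Δ x < BlockQuotient.mk D Δ y ↔ x.1 < y.1 ∧ ¬ D.toSetoid x.1 y.1 := by
  rw [lt_iff_le_and_ne, Ne, BlockQuotient.mk_le_iff, BlockQuotient.mk_eq_iff]
  constructor
  · rintro ⟨h | h, h'⟩
    · refine ⟨lt_of_le_of_ne h fun e => h' ?_, h'⟩
      rw [e]
    · exact absurd h h'
  · exact fun ⟨h, h'⟩ => ⟨Or.inl h.le, h'⟩

/-- The automorphism of `π(Δ)` induced by an element of `st(Δ)`. -/
def inducedAut (D : ConvexCongruence G) {Δ : Set Ω} (g : G.toSubgroup)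
    (hg : ∀ x, g.1 x ∈ Δ ↔ x ∈ Δ) : D.BlockQuotient Δ ≃o D.BlockQuotient Δ where
  toFun := Quotient.map (fun x : Δ => (⟨g.1 x.1, (hg x.1).2 x.2⟩ : Δ))
    fun _ _ h => D.map' g.1 g.2 _ _ h
  invFun := Quotient.map (fun x : Δ => (⟨(g⁻¹).1 x.1, by
      rw [← hg, apply_inv_self]; exact x.2⟩ : Δ))
    fun _ _ h => D.map' (g⁻¹).1 (g⁻¹).2 _ _ h
  left_inv p := by
    obtain ⟨x, rfl⟩ := BlockQuotient.mk_surjective D Δ p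
    exact congrArg (BlockQuotient.mk D Δ) (Subtype.ext (inv_apply_self g x.1))
  right_inv p := by
    obtain ⟨x, rfl⟩ := BlockQuotient.mk_surjective D Δ p
    exact congrArg (BlockQuotient.mk D Δ) (Subtype.ext (apply_inv_self g x.1))
  map_rel_iff' := by
    intro p q
    obtain ⟨x, rfl⟩ := BlockQuotient.mk_surjective D Δ p
    obtain ⟨y, rfl⟩ := BlockQuotient.mk_surjective D Δ q
    change g.1 x.1 ≤ g.1 y.1 ∨ D.toSetoid (g.1 x.1) (g.1 y.1) ↔ x.1 ≤ y.1 ∨ D.toSetoid x.1 y.1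
    rw [apply_rel_iff, g.1.le_iff_le]

theorem inducedAut_mk {Δ : Set Ω} (g : G.toSubgroup) (hg : ∀ x, g.1 x ∈ Δ ↔ x ∈ Δ) (x : Δ) :
    inducedAut D g hg (BlockQuotient.mk D Δ x) =
      BlockQuotient.mk D Δ ⟨g.1 x.1, (hg x.1).2 x.2⟩ := rfl

/-- The element of the component induced by an element of `st(Δ)`. -/
def toComponent (D : ConvexCongruence G) {Δ : Set Ω} (g : G.toSubgroup)
    (hg : ∀ x, g.1 x ∈ Δ ↔ x ∈ Δ) : (G.component D Δ).toSubgroup :=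
  ⟨inducedAut D g hg, g.1, ⟨g.2, hg⟩, fun x y h => by
    rw [inducedAut_mk]
    exact congrArg _ (Subtype.ext h)⟩

theorem toComponent_mk {Δ : Set Ω} (g : G.toSubgroup) (hg : ∀ x, g.1 x ∈ Δ ↔ x ∈ Δ) (x : Δ) :
    (toComponent D g hg).1 (BlockQuotient.mk D Δ x) =
      BlockQuotient.mk D Δ ⟨g.1 x.1, (hg x.1).2 x.2⟩ := rfl

theorem component_ext {Δ : Set Ω} {φ ψ : (G.component D Δ).toSubgroup}
    (h : ∀ x, φ.1 (BlockQuotient.mk D Δ x) = ψ.1 (BlockQuotient.mk D Δ x)) : φ = ψ := by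
  refine eq_iff_forall_apply.2 fun p => ?_
  obtain ⟨x, rfl⟩ := BlockQuotient.mk_surjective D Δ p
  exact h x

theorem toComponent_surjective {Δ : Set Ω} (φ : (G.component D Δ).toSubgroup) :
    ∃ g hg, toComponent D g hg = φ := by
  obtain ⟨φ, g, ⟨hg, hg'⟩, h⟩ := φ
  refine ⟨⟨g, hg⟩, hg', component_ext fun x => ?_⟩
  rw [toComponent_mk]
  exact (h x _ rfl).symm

theorem sup_mem_iff {Δ : Set Ω} {g k : G.toSubgroup} (hg : ∀ x, g.1 x ∈ Δ ↔ x ∈ Δ)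
    (hk : ∀ x, k.1 x ∈ Δ ↔ x ∈ Δ) (x : Ω) : (g ⊔ k).1 x ∈ Δ ↔ x ∈ Δ := by
  rw [sup_apply]
  rcases max_choice (g.1 x) (k.1 x) with e | e <;> rw [e]
  exacts [hg x, hk x]

theorem inf_mem_iff {Δ : Set Ω} {g k : G.toSubgroup} (hg : ∀ x, g.1 x ∈ Δ ↔ x ∈ Δ)
    (hk : ∀ x, k.1 x ∈ Δ ↔ x ∈ Δ) (x : Ω) : (g ⊓ k).1 x ∈ Δ ↔ x ∈ Δ := by
  rw [inf_apply]
  rcases min_choice (g.1 x) (k.1 x) with e | e <;> rw [e]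
  exacts [hg x, hk x]

theorem toComponent_sup {Δ : Set Ω} {g k : G.toSubgroup} (hg : ∀ x, g.1 x ∈ Δ ↔ x ∈ Δ)
    (hk : ∀ x, k.1 x ∈ Δ ↔ x ∈ Δ) :
    toComponent D (g ⊔ k) (sup_mem_iff hg hk) = toComponent D g hg ⊔ toComponent D k hk :=
  component_ext fun x => by
    rw [sup_apply, toComponent_mk, toComponent_mk, toComponent_mk]
    rcases le_total (g.1 x.1) (k.1 x.1) with e | e
    · rw [max_eq_right (BlockQuotient.mk_mono D Δ (Subtype.mk_le_mk.2 e))]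
      exact congrArg _ (Subtype.ext (max_eq_right e))
    · rw [max_eq_left (BlockQuotient.mk_mono D Δ (Subtype.mk_le_mk.2 e))]
      exact congrArg _ (Subtype.ext (max_eq_left e))

theorem toComponent_inf {Δ : Set Ω} {g k : G.toSubgroup} (hg : ∀ x, g.1 x ∈ Δ ↔ x ∈ Δ)
    (hk : ∀ x, k.1 x ∈ Δ ↔ x ∈ Δ) :
    toComponent D (g ⊓ k) (inf_mem_iff hg hk) = toComponent D g hg ⊓ toComponent D k hk :=
  component_ext fun x => by
    rw [inf_apply, toComponent_mk, toComponent_mk, toComponent_mk]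
    rcases le_total (g.1 x.1) (k.1 x.1) with e | e
    · rw [min_eq_left (BlockQuotient.mk_mono D Δ (Subtype.mk_le_mk.2 e))]
      exact congrArg _ (Subtype.ext (min_eq_left e))
    · rw [min_eq_right (BlockQuotient.mk_mono D Δ (Subtype.mk_le_mk.2 e))]
      exact congrArg _ (Subtype.ext (min_eq_right e))

theorem toComponent_eq_iff {Δ : Set Ω} {g k : G.toSubgroup} (hg : ∀ x, g.1 x ∈ Δ ↔ x ∈ Δ)
    (hk : ∀ x, k.1 x ∈ Δ ↔ x ∈ Δ) :
    toComponent D g hg = toComponent D k hk ↔ ∀ x ∈ Δ, D.toSetoid (g.1 x) (k.1 x) := by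
  refine ⟨fun h x hx => ?_, fun h => component_ext fun x => ?_⟩
  · have := eq_iff_forall_apply.1 h (BlockQuotient.mk D Δ ⟨x, hx⟩)
    rwa [toComponent_mk, toComponent_mk, BlockQuotient.mk_eq_iff] at this
  · rw [toComponent_mk, toComponent_mk, BlockQuotient.mk_eq_iff]
    exact h x.1 x.2

theorem one_mem_iff {Δ : Set Ω} (x : Ω) : (1 : G.toSubgroup).1 x ∈ Δ ↔ x ∈ Δ := Iff.rfl

theorem toComponent_one {Δ : Set Ω} : toComponent D (1 : G.toSubgroup) (one_mem_iff (Δ := Δ)) = 1 :=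
  component_ext fun _ => rfl

theorem toComponent_eq_one_iff {Δ : Set Ω} {g : G.toSubgroup} (hg : ∀ x, g.1 x ∈ Δ ↔ x ∈ Δ) :
    toComponent D g hg = 1 ↔ ∀ x ∈ Δ, D.toSetoid (g.1 x) x := by
  rw [← toComponent_one, toComponent_eq_iff]
  rfl

theorem component_isTransitive (hG : G.IsTransitive) :
    (G.component D (C.block α)).IsTransitive := by
  intro p q
  obtain ⟨x, rfl⟩ := BlockQuotient.mk_surjective D _ p
  obtain ⟨y, rfl⟩ := BlockQuotient.mk_surjective D _ q
  obtain ⟨g, hg, h⟩ := hG x.1 y.1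
  have hst : ∀ z, (⟨g, hg⟩ : G.toSubgroup).1 z ∈ C.block α ↔ z ∈ C.block α := fun z =>
    apply_mem_block_iff_of_rel x.2 (show g x.1 ∈ _ from h ▸ y.2)
  refine ⟨_, (toComponent D ⟨g, hg⟩ hst).2, ?_⟩
  rw [toComponent_mk]
  exact congrArg _ (Subtype.ext h)

/-- A congruence of the component pulls back to a convex congruence of G between D and C, and the
covering leaves only the two extremes. -/
theorem component_primitive (hDC : D ⋖ C)
    (E : ConvexCongruence (G.component D (C.block α))) :
    (∀ x y, E.toSetoid x y → x = y) ∨ ∀ x y, E.toSetoid x y := by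
  let Δ := C.block α
  -- E lives on the single block Δ; testing all translates that bring x and y into Δ spreads it
  -- invariantly over Ω.
  let F : ConvexCongruence G :=
    { r := fun x y => C.toSetoid x y ∧ ∀ g : G.toSubgroup, ∀ hx : g.1 x ∈ Δ, ∀ hy : g.1 y ∈ Δ,
        E.toSetoid (BlockQuotient.mk D Δ ⟨g.1 x, hx⟩) (BlockQuotient.mk D Δ ⟨g.1 y, hy⟩)
      iseqv :=
        { refl := fun x => ⟨C.toSetoid.refl' x, fun g hx hy => E.toSetoid.refl' _⟩
          symm := fun h => ⟨C.toSetoid.symm' h.1, fun g hx hy => E.toSetoid.symm' (h.2 g hy hx)⟩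
          trans := fun {x y z} h h' => ⟨C.toSetoid.trans' h.1 h'.1, fun g hx hz =>
            have hy : g.1 y ∈ Δ := C.toSetoid.trans' hx ((apply_rel_iff g).2 h.1)
            E.toSetoid.trans' (h.2 g hx hy) (h'.2 g hy hz)⟩ }
      map' := fun g hg x y h => ⟨C.map' g hg _ _ h.1, fun k hx hy =>
        h.2 (k * (⟨g, hg⟩ : G.toSubgroup)) hx hy⟩
      convex' := fun c => ⟨fun u hu v hv z hz => ⟨(C.convex' c).out hu.1 hv.1 hz, fun g hx hy =>
        (E.convex' _).out
          (hu.2 g hx (C.toSetoid.trans' hx ((apply_rel_iff g).2 hu.1)))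
          (hv.2 g hx (C.toSetoid.trans' hx ((apply_rel_iff g).2 hv.1)))
          ⟨Or.inl (g.1.monotone hz.1), Or.inl (g.1.monotone hz.2)⟩⟩⟩ }
  have hDF : D ≤ F := le_iff.2 fun x y h => ⟨le_iff.1 hDC.le _ _ h, fun g hx hy => by
    rw [(BlockQuotient.mk_eq_iff D Δ ⟨g.1 x, hx⟩ ⟨g.1 y, hy⟩).2 ((apply_rel_iff g).2 h)]⟩
  have hFC : F ≤ C := le_iff.2 fun x y h => h.1
  rcases hDC.eq_or_eq hDF hFC with h | h
  · left
    intro p q hpq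
    obtain ⟨x, rfl⟩ := BlockQuotient.mk_surjective D _ p
    obtain ⟨y, rfl⟩ := BlockQuotient.mk_surjective D _ q
    rw [BlockQuotient.mk_eq_iff, ← h]
    refine ⟨C.toSetoid.trans' (C.toSetoid.symm' x.2) y.2, fun g hx hy => ?_⟩
    have hst : ∀ z, g.1 z ∈ C.block α ↔ z ∈ C.block α := fun z =>
      apply_mem_block_iff_of_rel x.2 hx
    exact E.map' _ (toComponent D g hst).2 _ _ hpq
  · right
    intro p q
    obtain ⟨x, rfl⟩ := BlockQuotient.mk_surjective D _ p
    obtain ⟨y, rfl⟩ := BlockQuotient.mk_surjective D _ q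
    have hxy : F.toSetoid x.1 y.1 := by
      rw [h]
      exact C.toSetoid.trans' (C.toSetoid.symm' x.2) y.2
    exact hxy.2 1 x.2 y.2

/-- A component that is not o-2 transitive contains a positive element with a single bump. -/
theorem component_isO2Transitive_or_exists_bump (hG : G.IsTransitive) (hDC : D ⋖ C) (α : Ω) :
    (G.component D (C.block α)).IsO2Transitive ∨
      ∃ f : (G.component D (C.block α)).toSubgroup, 1 ≤ f ∧ ∀ x y, ∃ n : ℕ, x ≤ (f ^ n).1 y :=
  isO2Transitive_or_exists_bump (component_isTransitive hG) (component_primitive hDC)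

theorem exists_mk_lt_mk (hG : G.IsTransitive) (hDC : D ⋖ C) (α : Ω) :
    ∃ x y : C.block α, BlockQuotient.mk D (C.block α) x < BlockQuotient.mk D (C.block α) y := by
  obtain ⟨a, b, h, h'⟩ := exists_rel_not_rel_of_covBy hDC
  obtain ⟨g, hg, rfl⟩ := hG a α
  have hb : g b ∈ C.block (g a) := C.map' g hg _ _ h
  have hne : BlockQuotient.mk D (C.block (g a)) ⟨g a, mem_block_self⟩ ≠
      BlockQuotient.mk D (C.block (g a)) ⟨g b, hb⟩ := fun e =>
    h' ((apply_rel_iff ⟨g, hg⟩).1 ((BlockQuotient.mk_eq_iff D _ _ _).1 e))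
  rcases lt_or_gt_of_ne hne with h | h
  exacts [⟨_, _, h⟩, ⟨_, _, h⟩]

/-- A component that is not o-2 transitive has an element with a single bump, and such an element is
irreducible; the o-2 transitivity clause can thus be dropped. -/
theorem doubleDagger_iff (hG : G.IsTransitive) :
    G.DoubleDagger ↔ ∀ C ∈ G.spine, ∀ D : ConvexCongruence G, D ⋖ C → ∀ α : Ω,
      ∃ g : (G.component D (C.block α)).toSubgroup, IsIrreducibleElement g := by
  refine ⟨fun h C hC D hDC α => ?_, fun h C hC D hDC α _ => h C hC D hDC α⟩
  rcases component_isO2Transitive_or_exists_bump hG hDC α with h' | ⟨f, hf, hf'⟩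
  · exact h C hC D hDC α h'
  · obtain ⟨x, y, hxy⟩ := exists_mk_lt_mk hG hDC α
    exact ⟨f, isIrreducibleElement_of_bump hf hf' hxy⟩

end Component

end LPermGroup

/-! ### The subgroups supported on elements of the root system are uniformly definable -/

namespace LPermGroup

open ConvexCongruence

variable {Ω : Type*} [LinearOrder Ω] {G : LPermGroup Ω} {C D E F : ConvexCongruence G} {α β : Ω}

/-- The hull of `g` consists of all elements that are supported on `A`. -/
def Represents (g : G.toSubgroup) (A : Set Ω) : Prop := ∀ y, InHull g y ↔ IsSupportedOn A y

/-- The hull is a polar: anything orthogonal to the generating conjugates fixes every point moved by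
a member of the hull. -/
theorem inHull_iff (g y : G.toSubgroup) :
    InHull g y ↔ IsSupportedOn {x | ∃ b, InHull g b ∧ b.1 x ≠ x} y := by
  refine ⟨fun h x hx => not_not.1 fun h' => hx ⟨y, h, h'⟩, fun h z hz => perp_iff.2 fun x => ?_⟩
  by_cases hx : y.1 x = x
  · exact Or.inl hx
  · obtain ⟨b, hb, hbx⟩ := h.mem hx
    exact Or.inr ((perp_iff.1 (hb z hz) x).resolve_left hbx)

theorem IsSupportedOn.conj_of_mem {g h : G.toSubgroup} (hg : IsSupportedOn (C.block α) g) {x : Ω}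
    (hx : x ∈ C.block α) (hhx : h.1 x ∈ C.block α) : IsSupportedOn (C.block α) (h * g * h⁻¹) := by
  have h₁ := hg.conj h
  have h₂ : C.toSetoid α (h.1 α) :=
    C.toSetoid.trans' hhx (C.toSetoid.symm' ((apply_rel_iff h).2 hx))
  rwa [← block_eq h₂] at h₁

/-- A conjugate that meets g in support comes from an element stabilizing the block, so it is
supported there as well. If these conjugates cover the block, their polar is the set of elements
fixing the block pointwise, and abundance supplies enough of those to confine the double polar to
the block. -/
theorem represents_of_cover (hG : G.IsTransitive) (hA : G.IsAbundant) (hC : C ∈ G.spine)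
    {g : G.toSubgroup} (hg : IsSupportedOn (C.block α) g)
    (hcov : ∀ x ∈ C.block α, ∃ h : G.toSubgroup, ¬ Perp (h * g * h⁻¹) g ∧
      (h * g * h⁻¹).1 x ≠ x) : Represents g (C.block α) := by
  obtain ⟨a, b, hab, hCab⟩ := exists_ne_of_mem_spine hC
  refine fun y => ⟨fun hy x hx => ?_, fun hy z hz => perp_iff.2 fun x => ?_⟩
  · obtain ⟨z, hz, hzx⟩ := hA.exists_supported_moving hG hab hCab x
    refine (perp_iff.1 (hy z fun h hh => perp_iff.2 fun w => ?_) x).resolve_right hzx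
    rw [perp_iff] at hh
    push Not at hh
    obtain ⟨u, hu, hu'⟩ := hh
    have hs : IsSupportedOn (C.block α) (h * g * h⁻¹) :=
      hg.conj_of_mem (hg.mem ((conj_apply_ne_iff h g u).1 hu))
        (by rw [apply_inv_self]; exact hg.mem hu')
    by_contra! H
    exact hx (C.toSetoid.trans' (hs.mem H.1) (C.toSetoid.symm' (hz.mem H.2)))
  · by_cases hx : x ∈ C.block α
    · obtain ⟨h, hh, hhx⟩ := hcov x hx
      exact Or.inr ((perp_iff.1 (hz h hh) x).resolve_left hhx)
    · exact Or.inl (hy x hx)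

/-- Every element of the root system is described by some element of `G`. -/
theorem exists_represents (hG : G.IsTransitive) (hA : G.IsAbundant) (hC : C ∈ G.spine) (α : Ω) :
    ∃ g : G.toSubgroup, Represents g (C.block α) := by
  obtain ⟨D, hDC⟩ := exists_covBy hG hC
  have hP := component_isTransitive (C := C) (D := D) (α := α) hG
  obtain ⟨x₀, y₀, h₀⟩ := exists_mk_lt_mk hG hDC α
  rcases component_isO2Transitive_or_exists_bump hG hDC α with h₂ | ⟨f, hf, hbump⟩
  · obtain ⟨d, hd, hdx⟩ := hA.exists_supported_apply_eq hG hC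
      (C.toSetoid.trans' (C.toSetoid.symm' x₀.2) y₀.2)
    rw [← block_eq x₀.2] at hd
    have hlt : x₀.1 < y₀.1 := ((mk_lt_mk_iff _ _).1 h₀).1
    have below : ∀ p, ∃ q, q < p := fun p => by
      obtain ⟨φ, -, h⟩ := hP (BlockQuotient.mk D _ y₀) p
      exact ⟨_, h ▸ φ.strictMono h₀⟩
    have above : ∀ p, ∃ q, p < q := fun p => by
      obtain ⟨φ, -, h⟩ := hP (BlockQuotient.mk D _ x₀) p
      exact ⟨_, h ▸ φ.strictMono h₀⟩
    refine ⟨d, represents_of_cover hG hA hC hd fun x hx => ?_⟩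
    obtain ⟨p, hp⟩ := below (min (BlockQuotient.mk D _ ⟨x, hx⟩) (BlockQuotient.mk D _ x₀))
    obtain ⟨q, hq⟩ := above (max (BlockQuotient.mk D _ ⟨x, hx⟩) (BlockQuotient.mk D _ x₀))
    obtain ⟨hp₁, hp₂⟩ := lt_min_iff.1 hp
    obtain ⟨hq₁, hq₂⟩ := max_lt_iff.1 hq
    -- Carry the classes of x₀ < y₀ to p < q, which enclose both x and x₀. The conjugate of d then
    -- moves everything in between: it moves x, and it also moves x₀, so it is not orthogonal to d.
    obtain ⟨φ, hφ, hφp, hφq⟩ := h₂ _ _ _ _ h₀ (hp₁.trans hq₁)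
    obtain ⟨w, hw, e⟩ := toComponent_surjective ⟨φ, hφ⟩
    rw [← show (toComponent D w hw).1 = φ from congrArg Subtype.val e, toComponent_mk] at hφp hφq
    rw [← hφp, mk_lt_mk_iff] at hp₁ hp₂
    rw [← hφq, mk_lt_mk_iff] at hq₁ hq₂
    have hwx : (w * d * w⁻¹).1 (w.1 x₀) = w.1 y₀ := by
      refine (congrArg (fun z => w.1 (d.1 z)) (inv_apply_self w x₀.1)).trans ?_
      exact congrArg w.1 hdx
    have hmv : ∀ z, w.1 x₀ < z → z < w.1 y₀ → (w * d * w⁻¹).1 z ≠ z := fun z hz₁ hz₂ =>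
      apply_ne_of_mem_uIcc (u := w.1 x₀) (by rw [hwx]; exact fun e => hlt.ne' (w.1.injective e))
        (by rw [hwx, Set.uIcc_of_le (hz₁.trans hz₂).le]; exact ⟨hz₁.le, hz₂.le⟩)
    refine ⟨w, fun h => ?_, hmv x hp₁.1 hq₁.1⟩
    rcases perp_iff.1 h x₀ with h | h
    · exact hmv x₀ hp₂.1 hq₂.1 h
    · exact hlt.ne' (hdx.symm.trans h)
  · obtain ⟨k, hk, rfl⟩ := toComponent_surjective f
    obtain ⟨d, hd, hdk⟩ := hA.exists_restriction hC (a := α) (g := k) ((hk α).2 mem_block_self)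
    refine ⟨d, represents_of_cover hG hA hC hd fun x hx => ?_⟩
    -- Here d already moves every point of the block, so the trivial conjugate covers it: a fixed
    -- class would contradict the single bump.
    have hdx : d.1 x ≠ x := by
      intro h
      have hfix : (toComponent D k hk).1 (BlockQuotient.mk D _ ⟨x, hx⟩) =
          BlockQuotient.mk D _ ⟨x, hx⟩ := by
        rw [toComponent_mk]
        exact congrArg _ (Subtype.ext ((hdk x hx).symm.trans h))
      have hfix' : ∀ n : ℕ, (toComponent D k hk ^ n).1 (BlockQuotient.mk D _ ⟨x, hx⟩) =
          BlockQuotient.mk D _ ⟨x, hx⟩ := by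
        intro n
        induction n with
        | zero => rfl
        | succ n ih => rw [pow_succ]; exact (congrArg _ hfix).trans ih
      obtain ⟨φ, -, h⟩ := hP (BlockQuotient.mk D _ x₀) (BlockQuotient.mk D _ ⟨x, hx⟩)
      obtain ⟨n, hn⟩ := hbump (φ (BlockQuotient.mk D _ y₀)) (BlockQuotient.mk D _ ⟨x, hx⟩)
      rw [hfix', ← h] at hn
      exact hn.not_gt (φ.strictMono h₀)
    refine ⟨1, fun h => ?_, ?_⟩
    · rw [one_mul, inv_one, mul_one] at h
      exact hdx (or_self_iff.1 (perp_iff.1 h x))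
    · rwa [one_mul, inv_one, mul_one]

/-! ### Inclusion of hulls and the classes described by `IsBlockParam` -/

theorem Represents.inHull {g y : G.toSubgroup} {A : Set Ω} (h : Represents g A)
    (hy : IsSupportedOn A y) : InHull g y := (h y).2 hy

theorem Represents.hullLE_iff (hG : G.IsTransitive) (hA : G.IsAbundant) {p q : G.toSubgroup}
    {a b : Ω} (hab : a ≠ b) (hE : E.toSetoid a b) (hp : Represents p (E.block α)) {A : Set Ω}
    (hq : Represents q A) : HullLE p q ↔ E.block α ⊆ A := by
  refine ⟨fun h x hx => ?_, fun h y hy => hq.inHull (((hp y).1 hy).mono h)⟩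
  obtain ⟨d, hd, hdx⟩ := hA.exists_supported_moving hG hab hE x
  rw [← block_eq hx] at hd
  exact ((hq d).1 (h d (hp.inHull hd))).mem hdx

theorem Represents.hullLE_iff_of_mem_spine (hG : G.IsTransitive) (hA : G.IsAbundant)
    {p q : G.toSubgroup} (hC : C ∈ G.spine) (hp : Represents p (C.block α))
    (hq : Represents q (E.block β)) : HullLE p q ↔ E.toSetoid β α ∧ C ≤ E := by
  obtain ⟨a, b, hab, h⟩ := exists_ne_of_mem_spine hC
  rw [hp.hullLE_iff hG hA hab h hq, block_subset_block_iff' hG]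

/-- The last two clauses reflect that translates of a block are equal or disjoint, and that the
elements supported on a block of the spine act transitively on it. -/
theorem Represents.isBlockParam (hG : G.IsTransitive) (hA : G.IsAbundant) (hC : C ∈ G.spine)
    {g : G.toSubgroup} (hg : Represents g (C.block α)) : IsBlockParam g := by
  obtain ⟨a, b, hab, hCab⟩ := exists_ne_of_mem_spine hC
  refine ⟨?_, fun h b hb hb₁ hhb c hc => ?_, fun x hx hx₁ y hy hy₁ => ?_⟩
  · obtain ⟨d, hd, hdx⟩ := hA.exists_supported_moving hG hab hCab α
    exact ⟨d, hg.inHull hd, fun e => hdx (by rw [e]; rfl)⟩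
  · obtain ⟨x, hx⟩ := exists_apply_ne hb₁
    rw [hg] at hb hhb hc ⊢
    exact hc.conj_of_mem (hb.mem hx) (hhb.mem ((conj_apply_apply_ne_iff h b x).2 hx))
  · obtain ⟨u, hu⟩ := exists_apply_ne hx₁
    obtain ⟨v, hv⟩ := exists_apply_ne hy₁
    rw [hg] at hx hy
    have hu' := hx.mem hu
    obtain ⟨d, hd, rfl⟩ := hA.exists_supported_apply_eq hG hC
      (C.toSetoid.trans' (C.toSetoid.symm' hu') (hy.mem hv))
    rw [← block_eq hu'] at hd
    exact ⟨d, hg.inHull hd, fun h =>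
      (perp_iff.1 h (d.1 u)).elim ((conj_apply_apply_ne_iff d x u).2 hu) hv⟩

/-- The support of a hull that satisfies `IsBlockParam` is a class of a convex congruence. -/
theorem exists_represents_of_isBlockParam (hG : G.IsTransitive) (hA : G.IsAbundant)
    {g : G.toSubgroup} (hg : IsBlockParam g) :
    ∃ (E : ConvexCongruence G) (a b : Ω), a ≠ b ∧ E.toSetoid a b ∧ Represents g (E.block a) := by
  obtain ⟨⟨b₀, hb₀, hb₀'⟩, hblock, hirr⟩ := hg
  obtain ⟨a, ha⟩ := exists_apply_ne hb₀'
  let A : Set Ω := {x | ∃ b, InHull g b ∧ b.1 x ≠ x}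
  have hgA : Represents g A := inHull_iff g
  have sub : ∀ (h : G.toSubgroup) x, x ∈ A → h.1 x ∈ A → ∀ y ∈ A, h.1 y ∈ A := by
    rintro h x ⟨b, hb, hbx⟩ ⟨b', hb', hbx'⟩ y ⟨c, hc, hcy⟩
    -- The support of k = |h b h⁻¹| ∧ |b'| is the intersection of the two supports. Hence k and h⁻¹
    -- k h both lie in the hull, and k ≠ 1 since it moves h x.
    let k : G.toSubgroup := ((h * b * h⁻¹) ⊔ (h * b * h⁻¹)⁻¹) ⊓ (b' ⊔ b'⁻¹)
    have hk : ∀ z, k.1 z ≠ z ↔ ¬ ((h * b * h⁻¹).1 z = z ∨ b'.1 z = z) := by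
      have le : ∀ (u : G.toSubgroup) z, z ≤ (u ⊔ u⁻¹).1 z := fun u z => by
        by_cases hz : u.1 z = z
        · exact (sup_inv_apply_eq hz).ge
        · exact (lt_sup_inv_apply hz).le
      intro z
      refine not_congr ⟨fun e => ?_, ?_⟩
      · by_contra! H
        exact (lt_min (lt_sup_inv_apply H.1) (lt_sup_inv_apply H.2)).ne' e
      · rintro (e | e)
        · exact (min_eq_left ((sup_inv_apply_eq e).trans_le (le b' z))).trans (sup_inv_apply_eq e)
        · exact (min_eq_right ((sup_inv_apply_eq e).trans_le (le _ z))).trans (sup_inv_apply_eq e)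
    have hkA : InHull g k := (hgA k).2 fun z hz => by
      by_contra H
      have := (hk z).1 H
      push Not at this
      exact hz ⟨b', hb', this.2⟩
    have e : h * (h⁻¹ * k * h) * h⁻¹ = k := by group
    have hkA' : InHull g (h⁻¹ * k * h) := (hgA _).2 fun z hz => by
      by_contra H
      rw [← ne_eq, ← conj_apply_apply_ne_iff h, e, hk] at H
      push Not at H
      exact hz ⟨b, hb, (conj_apply_apply_ne_iff h b z).1 H.1⟩
    have hk₁ : k ≠ 1 := fun e => (hk (h.1 x)).2
      (not_or.2 ⟨(conj_apply_apply_ne_iff h b x).2 hbx, hbx'⟩) (by rw [e]; rfl)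
    refine ⟨_, hblock h (h⁻¹ * k * h) hkA' (fun e' => hk₁ ?_) (by rwa [e]) c hc,
      (conj_apply_apply_ne_iff h c y).2 hcy⟩
    rw [← e, e']
    group
  -- The translates of A; by `sub` two of them that meet coincide.
  let T : G.toSubgroup → Set Ω := fun h => {x | (h⁻¹).1 x ∈ A}
  have hT : ∀ (h k : G.toSubgroup) x, x ∈ T h → x ∈ T k → T h ⊆ T k := by
    intro h k x hx hx' y hy
    have := sub (k⁻¹ * h) ((h⁻¹).1 x) hx
      (by change (k⁻¹).1 (h.1 ((h⁻¹).1 x)) ∈ A; rw [apply_inv_self]; exact hx') _ hy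
    change (k⁻¹).1 (h.1 ((h⁻¹).1 y)) ∈ A at this
    rwa [apply_inv_self] at this
  have hT₁ : T 1 = A := by
    ext x
    change (1⁻¹ : G.toSubgroup).1 x ∈ A ↔ _
    rw [inv_one]
    rfl
  -- A is not yet known to be convex, so points are related when the whole interval between them
  -- lies in one translate; the classes are the convex pieces of the translates.
  let E : ConvexCongruence G :=
    { r := fun x y => ∃ h, Set.uIcc x y ⊆ T h
      iseqv :=
        { refl := fun x => by
            obtain ⟨h, hh, rfl⟩ := hG a x
            refine ⟨⟨h, hh⟩, ?_⟩
            rw [Set.uIcc_self, Set.singleton_subset_iff]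
            change ((⟨h, hh⟩ : G.toSubgroup)⁻¹).1 ((⟨h, hh⟩ : G.toSubgroup).1 a) ∈ A
            rw [inv_apply_self]
            exact ⟨b₀, hb₀, ha⟩
          symm := fun ⟨h, hh⟩ => ⟨h, by rwa [Set.uIcc_comm]⟩
          trans := fun ⟨h, hh⟩ ⟨k, hk⟩ => ⟨h, Set.uIcc_subset_uIcc_union_uIcc.trans
            (Set.union_subset hh (hk.trans (hT k h _ (hk Set.left_mem_uIcc)
              (hh Set.right_mem_uIcc))))⟩ }
      map' := by
        rintro k hk x y ⟨h, hh⟩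
        refine ⟨⟨k, hk⟩ * h, fun z hz => ?_⟩
        change ((⟨k, hk⟩ * h)⁻¹ : G.toSubgroup).1 z ∈ A
        rw [mul_inv_rev]
        have hm := ((⟨k, hk⟩ : G.toSubgroup)⁻¹).1.monotone.image_uIcc_subset
          (Set.mem_image_of_mem _ hz)
        have e : ∀ w, ((⟨k, hk⟩ : G.toSubgroup)⁻¹).1 (k w) = w :=
          inv_apply_self (⟨k, hk⟩ : G.toSubgroup)
        rw [e, e] at hm
        exact hh hm
      convex' := fun c => ⟨fun u ⟨h, hh⟩ v ⟨k, hk⟩ z hz => ⟨h, by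
        have hk' : Set.uIcc c v ⊆ T h :=
          hk.trans (hT k h c (hk Set.left_mem_uIcc) (hh Set.left_mem_uIcc))
        refine (Set.uIcc_subset_uIcc_union_uIcc (b := u)).trans (Set.union_subset hh ?_)
        refine (Set.uIcc_subset_uIcc Set.left_mem_uIcc ?_).trans
          ((Set.uIcc_subset_uIcc_union_uIcc (b := c)).trans
            (Set.union_subset (Set.uIcc_comm c u ▸ hh) hk'))
        rw [Set.uIcc_of_le (hz.1.trans hz.2)]
        exact hz⟩⟩ }
  have hEA : ∀ x ∈ A, E.block x ⊆ A := by
    rintro x hx y ⟨h, hh⟩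
    rw [← hT₁] at hx ⊢
    exact hT h 1 x (hh Set.left_mem_uIcc) hx (hh Set.right_mem_uIcc)
  have hmove : ∀ b, InHull g b → ∀ x, E.toSetoid x (b.1 x) := by
    intro b hb x
    by_cases hx : b.1 x = x
    · rw [hx]
    · refine ⟨1, fun z hz => ?_⟩
      rw [hT₁]
      exact ⟨b, hb, apply_ne_of_mem_uIcc hx hz⟩
  have hsmall : ∀ x ∈ A, ∃ d, InHull g d ∧ d ≠ 1 ∧ IsSupportedOn (E.block x) d := by
    rintro x ⟨b, hb, hbx⟩
    obtain ⟨d, hd, hdx⟩ := hA.exists_supported_moving hG hbx.symm (hmove b hb x) x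
    exact ⟨d, hgA.inHull (hd.mono (hEA x ⟨b, hb, hbx⟩)), fun e => hdx (by rw [e]; rfl), hd⟩
  have haA : a ∈ A := ⟨b₀, hb₀, ha⟩
  refine ⟨E, a, b₀.1 a, ha.symm, hmove b₀ hb₀ a, ?_⟩
  -- Members of the hull preserve each E-class. Elements supported on the classes of a and of c can
  -- therefore be made non-orthogonal by conjugation within the hull only if the classes agree, so A
  -- is one class.
  rw [show E.block a = A from (hEA a haA).antisymm fun c hc => ?_]
  · exact hgA
  obtain ⟨x, hx, hx₁, hxs⟩ := hsmall a haA
  obtain ⟨y, hy, hy₁, hys⟩ := hsmall c hc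
  obtain ⟨b, hb, hperp⟩ := hirr x hx hx₁ y hy hy₁
  rw [perp_iff] at hperp
  push Not at hperp
  obtain ⟨z, hz, hz'⟩ := hperp
  have h₁ : E.toSetoid a ((b⁻¹).1 z) := hxs.mem ((conj_apply_ne_iff b x z).1 hz)
  have h₂ := hmove b hb ((b⁻¹).1 z)
  rw [apply_inv_self] at h₂
  exact E.toSetoid.trans' (E.toSetoid.trans' h₁ h₂) (E.toSetoid.symm' (hys.mem hz'))

/-! ### Recognizing the members of the spine -/

theorem exists_spine_between (hG : G.IsTransitive) (hE : E ∉ G.spine) (hFE : F < E) :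
    ∃ C ∈ G.spine, F ≤ C ∧ C < E := by
  have := hFE.not_ge
  rw [le_iff] at this
  push Not at this
  obtain ⟨a, b, h, h'⟩ := this
  have hab : a ≠ b := fun e => h' (e ▸ F.toSetoid.refl' a)
  have hV := V_mem_spine (G := G) hab
  refine ⟨_, hV, le_of_not_le hG fun h => h' (V_le_iff.1 h), lt_of_le_of_ne (V_le_iff.2 h) ?_⟩
  rintro rfl
  exact hE hV

theorem exists_spine_ge_rel (hG : G.IsTransitive) (hC : C ∈ G.spine) (hCE : C < E)
    (hV : G.V α β < E) : ∃ F ∈ G.spine, C ≤ F ∧ F < E ∧ F.toSetoid α β := by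
  rcases ConvexCongruence.le_total hG C (G.V α β) with h | h
  · by_cases hαβ : α = β
    · exact ⟨C, hC, le_rfl, hCE, hαβ ▸ C.toSetoid.refl' α⟩
    · exact ⟨_, V_mem_spine hαβ, h, hV, V_rel α β⟩
  · exact ⟨C, hC, le_rfl, hCE, V_le_iff.1 h⟩

/-- The formula `IsRootParam` singles out the elements that describe elements of `T`. -/
theorem isRootParam_iff (hG : G.IsTransitive) (hA : G.IsAbundant) {g : G.toSubgroup} :
    IsRootParam g ↔ ∃ C ∈ G.spine, ∃ α, Represents g (C.block α) := by
  constructor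
  · rintro ⟨hg, hg'⟩
    obtain ⟨E, a, b, hab, hE, hgE⟩ := exists_represents_of_isBlockParam hG hA hg
    refine ⟨E, not_not.1 fun hns => ?_, a, hgE⟩
    have lt_of_rel : ∀ x y, x ≠ y → E.toSetoid x y → G.V x y < E := fun x y hxy h =>
      lt_of_le_of_ne (V_le_iff.2 h) fun e => hns (e ▸ V_mem_spine hxy)
    have large : ∀ C ∈ G.spine, C < E → ∀ x r, Represents r (C.block x) → ¬ HullLE g r := by
      intro C hC hCE x r hr h
      rw [hgE.hullLE_iff hG hA hab hE hr, block_subset_block_iff' hG] at h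
      exact hCE.not_ge h.2
    have hVE := lt_of_rel a b hab hE
    -- Both alternatives fail for E outside the spine: V(a, b) is a spine member properly below E,
    -- and any two classes properly inside the E-class lie in a block of one spine member F < E.
    rcases hg' with h | ⟨p, q, hp, hq, hpg, hqg, hgp, hgq, h⟩
    · obtain ⟨p, hp⟩ := exists_represents hG hA (V_mem_spine hab) a
      refine large _ (V_mem_spine hab) hVE a p hp (h p ?_ ?_)
      · exact hp.isBlockParam hG hA (V_mem_spine hab)
      · rw [hp.hullLE_iff_of_mem_spine hG hA (V_mem_spine hab) hgE]
        exact ⟨E.toSetoid.refl' a, hVE.le⟩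
    · have lift : ∀ p : G.toSubgroup, IsBlockParam p → HullLE p g → ¬ HullLE g p →
          ∃ C ∈ G.spine, C < E ∧ ∃ x, E.toSetoid a x ∧ ∀ F, C ≤ F → ∀ r,
            Represents r (F.block x) → HullLE p r := by
        intro p hp hpg hgp
        obtain ⟨F, c, d, hcd, hF, hpF⟩ := exists_represents_of_isBlockParam hG hA hp
        rw [hpF.hullLE_iff hG hA hcd hF hgE, block_subset_block_iff' hG] at hpg
        rw [hgE.hullLE_iff hG hA hab hE hpF, block_subset_block_iff' hG] at hgp
        have hFE : F < E := lt_of_le_not_ge hpg.2 fun h =>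
          hgp ⟨F.toSetoid.symm' (le_iff.1 h _ _ hpg.1), h⟩
        obtain ⟨C, hC, hFC, hCE⟩ := exists_spine_between hG hns hFE
        refine ⟨C, hC, hCE, c, hpg.1, fun F' hF' r hr => ?_⟩
        rw [hpF.hullLE_iff hG hA hcd hF hr]
        exact block_mono (hFC.trans hF')
      obtain ⟨C₁, hC₁, hCE₁, x, hx, hpr⟩ := lift p hp hpg hgp
      obtain ⟨C₂, hC₂, hCE₂, y, hy, hqr⟩ := lift q hq hqg hgq
      have hxy : G.V x y < E := by
        by_cases e : x = y
        · subst e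
          exact lt_of_le_of_lt (V_le_iff.2 ((G.V a b).toSetoid.refl' x)) hVE
        · exact lt_of_rel x y e (E.toSetoid.trans' (E.toSetoid.symm' hx) hy)
      obtain ⟨C, hC, hCE, h₁, h₂⟩ : ∃ C ∈ G.spine, C < E ∧ C₁ ≤ C ∧ C₂ ≤ C := by
        rcases ConvexCongruence.le_total hG C₁ C₂ with h | h
        exacts [⟨C₂, hC₂, hCE₂, h, le_rfl⟩, ⟨C₁, hC₁, hCE₁, le_rfl, h⟩]
      obtain ⟨F, hF, hCF, hFE, hFxy⟩ := exists_spine_ge_rel hG hC hCE hxy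
      obtain ⟨r, hr⟩ := exists_represents hG hA hF x
      refine large F hF hFE x r hr (h r (hr.isBlockParam hG hA hF) (hpr F (h₁.trans hCF) r hr)
        (hqr F (h₂.trans hCF) r (block_eq hFxy ▸ hr)) ?_)
      rw [hr.hullLE_iff_of_mem_spine hG hA hF hgE]
      exact ⟨hx, hFE.le⟩
  · rintro ⟨C, hC, α, hg⟩
    refine ⟨hg.isBlockParam hG hA hC, ?_⟩
    by_cases hmin : ∃ F ∈ G.spine, F < C
    · right
      obtain ⟨F, hF, hFC⟩ := hmin
      obtain ⟨D, hDC⟩ := exists_covBy hG hC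
      obtain ⟨a, b, h, h'⟩ := exists_rel_not_rel_of_covBy hDC
      obtain ⟨k, hk, rfl⟩ := hG a α
      have hβ : C.toSetoid (k a) (k b) := C.map' k hk _ _ h
      have hβ' : ¬ D.toSetoid (k a) (k b) := fun e => h' ((apply_rel_iff ⟨k, hk⟩).1 e)
      have hV := V_eq_of_covBy hG hDC hβ hβ'
      -- Since V(k a, k b) = C, a class containing small blocks around both points contains the
      -- whole C-block; this defeats directedness.
      obtain ⟨p, hp⟩ := exists_represents hG hA hF (k a)
      obtain ⟨q, hq⟩ := exists_represents hG hA hF (k b)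
      refine ⟨p, q, hp.isBlockParam hG hA hF, hq.isBlockParam hG hA hF, ?_, ?_, ?_, ?_, ?_⟩
      · rw [hp.hullLE_iff_of_mem_spine hG hA hF hg]
        exact ⟨C.toSetoid.refl' _, hFC.le⟩
      · rw [hq.hullLE_iff_of_mem_spine hG hA hF hg]
        exact ⟨hβ, hFC.le⟩
      · rw [hg.hullLE_iff_of_mem_spine hG hA hC hp]
        exact fun h => hFC.not_ge h.2
      · rw [hg.hullLE_iff_of_mem_spine hG hA hC hq]
        exact fun h => hFC.not_ge h.2
      · intro r hr hpr hqr _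
        obtain ⟨E, c, d, -, -, hrE⟩ := exists_represents_of_isBlockParam hG hA hr
        rw [hp.hullLE_iff_of_mem_spine hG hA hF hrE] at hpr
        rw [hq.hullLE_iff_of_mem_spine hG hA hF hrE] at hqr
        rw [hg.hullLE_iff_of_mem_spine hG hA hC hrE, ← hV, V_le_iff]
        exact ⟨hpr.1, E.toSetoid.trans' (E.toSetoid.symm' hpr.1) hqr.1⟩
    · left
      intro p hp hpg
      obtain ⟨E, c, d, hcd, hE, hpE⟩ := exists_represents_of_isBlockParam hG hA hp
      rw [hpE.hullLE_iff hG hA hcd hE hg, block_subset_block_iff' hG] at hpg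
      -- E relates distinct c, d, and V(c, d) cannot lie properly below the minimal C, so it equals
      -- C.
      have hCE : C ≤ E := by
        have h₁ : G.V c d ≤ C := V_le_iff.2 (le_iff.1 hpg.2 _ _ hE)
        have h₂ : G.V c d = C := h₁.eq_of_not_lt fun h => hmin ⟨_, V_mem_spine hcd, h⟩
        rw [← h₂]
        exact V_le_iff.2 hE
      rw [hg.hullLE_iff_of_mem_spine hG hA hC hpE]
      exact ⟨E.toSetoid.symm' (le_iff.1 hCE _ _ hpg.1), hCE⟩

/-! ### Recovering the action on an o-primitive component -/

theorem Represents.stabilizesHull_iff (hG : G.IsTransitive) (hA : G.IsAbundant) (hC : C ∈ G.spine)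
    {g k : G.toSubgroup} (hg : Represents g (C.block α)) :
    StabilizesHull g k ↔ ∀ x, k.1 x ∈ C.block α ↔ x ∈ C.block α := by
  constructor
  · intro h
    obtain ⟨a, b, hab, hCab⟩ := exists_ne_of_mem_spine hC
    obtain ⟨d, hd, hdx⟩ := hA.exists_supported_moving hG hab hCab α
    have hk := (hg _).1 ((h d).1 (hg.inHull hd))
    exact fun x => apply_mem_block_iff_of_rel mem_block_self
      (hk.mem ((conj_apply_apply_ne_iff k d α).2 hdx))
  · intro h y
    rw [hg, hg]
    refine ⟨fun hy => hy.conj_of_mem mem_block_self ((h α).2 mem_block_self), fun hy x hx => ?_⟩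
    by_contra H
    exact hx ((h x).1 (hy.mem ((conj_apply_apply_ne_iff k y x).2 H)))

theorem Represents.isRootParamBelow_iff (hG : G.IsTransitive) (hA : G.IsAbundant)
    (hC : C ∈ G.spine) {g p : G.toSubgroup} (hg : Represents g (C.block α)) :
    IsRootParamBelow g p ↔
      ∃ F ∈ G.spine, F < C ∧ ∃ β ∈ C.block α, Represents p (F.block β) := by
  rw [IsRootParamBelow, isRootParam_iff hG hA]
  constructor
  · rintro ⟨⟨F, hF, β, hp⟩, h, h'⟩
    rw [hp.hullLE_iff_of_mem_spine hG hA hF hg] at h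
    rw [hg.hullLE_iff_of_mem_spine hG hA hC hp] at h'
    exact ⟨F, hF, lt_of_le_not_ge h.2 fun e => h' ⟨F.toSetoid.symm' (le_iff.1 e _ _ h.1), e⟩, β,
      h.1, hp⟩
  · rintro ⟨F, hF, hFC, β, hβ, hp⟩
    refine ⟨⟨F, hF, β, hp⟩, ?_, ?_⟩
    · rw [hp.hullLE_iff_of_mem_spine hG hA hF hg]
      exact ⟨hβ, hFC.le⟩
    · rw [hg.hullLE_iff_of_mem_spine hG hA hC hp]
      exact fun h => hFC.not_ge h.2

/-- The covered congruence D need not lie in the spine, so the formula approximates it from below: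
if there are spine members below C, k is trivial on π(Δ) when each smaller block in Δ and its image
under k lie in a common smaller block. If there are none, D is equality and k must fix Δ pointwise.
-/
theorem Represents.trivialOnHull_iff (hG : G.IsTransitive) (hA : G.IsAbundant)
    (hC : C ∈ G.spine) (hDC : D ⋖ C) {g k : G.toSubgroup} (hg : Represents g (C.block α)) :
    TrivialOnHull g k ↔ ∀ x ∈ C.block α, D.toSetoid (k.1 x) x := by
  constructor
  · rintro (h | ⟨⟨p, hp⟩, h⟩) x hx
    · obtain ⟨a, b, hab, hCab⟩ := exists_ne_of_mem_spine hC
      obtain ⟨d, hd, hdx⟩ := hA.exists_supported_moving hG hab hCab x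
      rw [← block_eq hx] at hd
      rw [(perp_iff.1 (h d (hg.inHull hd)) x).resolve_right hdx]
    · obtain ⟨F, hF, hFC, -⟩ := (hg.isRootParamBelow_iff hG hA hC).1 hp
      obtain ⟨p, hp⟩ := exists_represents hG hA hF x
      obtain ⟨q, hq, hpq, hkq⟩ :=
        h p ((hg.isRootParamBelow_iff hG hA hC).2 ⟨F, hF, hFC, x, hx, hp⟩)
      obtain ⟨F', -, hFC', β, -, hq⟩ := (hg.isRootParamBelow_iff hG hA hC).1 hq
      rw [hp.hullLE_iff_of_mem_spine hG hA hF hq] at hpq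
      obtain ⟨a, b, hab, hFab⟩ := exists_ne_of_mem_spine hF
      obtain ⟨d, hd, hdx⟩ := hA.exists_supported_moving hG hab hFab x
      have hkx := ((hq _).1 (hkq d (hp.inHull hd))).mem ((conj_apply_apply_ne_iff k d x).2 hdx)
      exact le_iff.1 (le_of_covBy hG hDC hFC') _ _
        (F'.toSetoid.trans' (F'.toSetoid.symm' hkx) hpq.1)
  · intro h
    by_cases hmin : ∃ F ∈ G.spine, F < C
    · right
      obtain ⟨F, hF, hFC⟩ := hmin
      obtain ⟨p, hp⟩ := exists_represents hG hA hF α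
      refine ⟨⟨p, (hg.isRootParamBelow_iff hG hA hC).2 ⟨F, hF, hFC, α, mem_block_self, hp⟩⟩, ?_⟩
      intro p hp
      obtain ⟨F, hF, hFC, β, hβ, hp⟩ := (hg.isRootParamBelow_iff hG hA hC).1 hp
      have hV : G.V β (k.1 β) < C :=
        lt_of_le_of_lt (V_le_iff.2 (D.toSetoid.symm' (h β hβ))) hDC.lt
      obtain ⟨F', hF', hFF', hFC', hrel⟩ := exists_spine_ge_rel hG hF hFC hV
      obtain ⟨q, hq⟩ := exists_represents hG hA hF' β
      refine ⟨q, (hg.isRootParamBelow_iff hG hA hC).2 ⟨F', hF', hFC', β, hβ, hq⟩, ?_, ?_⟩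
      · rw [hp.hullLE_iff_of_mem_spine hG hA hF hq]
        exact ⟨F'.toSetoid.refl' β, hFF'⟩
      · intro y hy
        refine hq.inHull ((((hp y).1 hy).conj k).mono ?_)
        rw [block_eq hrel]
        exact block_mono hFF'
    · left
      intro y hy
      refine perp_iff.2 fun x => ?_
      by_cases hx : x ∈ C.block α
      · left
        by_contra H
        exact hmin ⟨_, V_mem_spine H, lt_of_le_of_lt (V_le_iff.2 (h x hx)) hDC.lt⟩
      · exact Or.inr ((hg y).1 hy x hx)

theorem Represents.hasIrreducibleOnHull_iff (hG : G.IsTransitive) (hA : G.IsAbundant)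
    (hC : C ∈ G.spine) (hDC : D ⋖ C) {g : G.toSubgroup} (hg : Represents g (C.block α)) :
    HasIrreducibleOnHull g ↔
      ∃ f : (G.component D (C.block α)).toSubgroup, IsIrreducibleElement f := by
  have triv : ∀ (k : G.toSubgroup) (hk : ∀ x, k.1 x ∈ C.block α ↔ x ∈ C.block α),
      TrivialOnHull g k ↔ toComponent D k hk = 1 := fun k hk => by
    rw [hg.trivialOnHull_iff hG hA hC hDC, toComponent_eq_one_iff]
  -- Elements of the component are equal when their representatives agree modulo the kernel of st(Δ)
  -- → G(Δ); this accounts for k⁻¹ in the formula.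
  have triv_inv_mul : ∀ (k l : G.toSubgroup) (hk : ∀ x, k.1 x ∈ C.block α ↔ x ∈ C.block α)
      (hl : ∀ x, l.1 x ∈ C.block α ↔ x ∈ C.block α),
      TrivialOnHull g (k⁻¹ * l) ↔ toComponent D l hl = toComponent D k hk := fun k l hk hl => by
    rw [hg.trivialOnHull_iff hG hA hC hDC, toComponent_eq_iff]
    refine forall₂_congr fun x _ => ?_
    rw [← apply_rel_iff k]
    exact iff_of_eq (congrArg (fun z => D.toSetoid z (k.1 x)) (apply_inv_self k (l.1 x)))
  constructor
  · rintro ⟨k, hk, hk₁, hnt, h⟩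
    rw [hg.stabilizesHull_iff hG hA hC] at hk
    refine ⟨toComponent D k hk, lt_of_le_of_ne ?_ fun e => hnt ((triv k hk).2 e.symm), ?_⟩
    · intro p
      obtain ⟨x, rfl⟩ := BlockQuotient.mk_surjective D _ p
      rw [toComponent_mk]
      exact BlockQuotient.mk_mono D _ (Subtype.mk_le_mk.2 (hk₁ x.1))
    · intro f₁ f₂ hs hi
      obtain ⟨k₁, hk₁, rfl⟩ := toComponent_surjective f₁
      obtain ⟨k₂, hk₂, rfl⟩ := toComponent_surjective f₂
      rw [← toComponent_sup hk₁ hk₂] at hs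
      rw [← toComponent_inf hk₁ hk₂] at hi
      rw [← triv k₁ hk₁, ← triv k₂ hk₂]
      exact h k₁ k₂ ((hg.stabilizesHull_iff hG hA hC).2 hk₁)
        ((hg.stabilizesHull_iff hG hA hC).2 hk₂) ((triv_inv_mul _ _ hk _).2 hs)
        ((triv _ _).2 hi)
  · rintro ⟨f, hf, h⟩
    obtain ⟨k₀, hk₀, rfl⟩ := toComponent_surjective f
    -- Positivity in the component gives k₀ ≥ 1 only modulo D, while the formula wants a positive
    -- element; the join with 1 induces the same automorphism.
    have hk := sup_mem_iff hk₀ (one_mem_iff (G := G) (Δ := C.block α))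
    have e : toComponent D (k₀ ⊔ 1) hk = toComponent D k₀ hk₀ := by
      rw [toComponent_sup hk₀ one_mem_iff, toComponent_one]
      exact sup_eq_left.2 hf.le
    refine ⟨k₀ ⊔ 1, (hg.stabilizesHull_iff hG hA hC).2 hk, le_sup_right, ?_, ?_⟩
    · rw [triv _ hk, e]
      exact hf.ne'
    · intro k₁ k₂ hk₁ hk₂ hs hi
      rw [hg.stabilizesHull_iff hG hA hC] at hk₁ hk₂
      rw [triv k₁ hk₁, triv k₂ hk₂]
      refine h _ _ ?_ ?_
      · rw [← toComponent_sup hk₁ hk₂, ← e]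
        exact (triv_inv_mul _ _ hk _).1 hs
      · rw [← toComponent_inf hk₁ hk₂]
        exact (triv _ _).1 hi

/-- Condition `(††)` is expressed by a sentence about the `ℓ`-group. -/
theorem doubleDagger_iff_hasIrreducibleOnHull (hG : G.IsTransitive) (hA : G.IsAbundant) :
    G.DoubleDagger ↔ ∀ g : G.toSubgroup, IsRootParam g → HasIrreducibleOnHull g := by
  rw [doubleDagger_iff hG]
  constructor
  · intro h g hg
    obtain ⟨C, hC, α, hg⟩ := (isRootParam_iff hG hA).1 hg
    obtain ⟨D, hDC⟩ := exists_covBy hG hC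
    exact (hg.hasIrreducibleOnHull_iff hG hA hC hDC).2 (h C hC D hDC α)
  · intro h C hC D hDC α
    obtain ⟨g, hg⟩ := exists_represents hG hA hC α
    exact (hg.hasIrreducibleOnHull_iff hG hA hC hDC).1
      (h g ((isRootParam_iff hG hA).2 ⟨C, hC, α, hg⟩))

/-- Conjugation by h translates blocks, and transitivity brings the block at α to the one at β; only
the congruences remain to be compared. -/
theorem Represents.conjHullLE_iff (hG : G.IsTransitive) (hA : G.IsAbundant) {p q : G.toSubgroup}
    (hC : C ∈ G.spine) (hp : Represents p (C.block α)) (hq : Represents q (D.block β)) :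
    ConjHullLE p q ↔ C ≤ D := by
  constructor
  · rintro ⟨h, hh⟩
    obtain ⟨a, b, hab, hCab⟩ := exists_ne_of_mem_spine hC
    refine (block_subset_block_iff' (a := h.1 α) (b := β) hG).1 (fun x hx => ?_) |>.2
    rw [← apply_inv_self h x] at hx ⊢
    rw [apply_mem_block_iff] at hx
    obtain ⟨d, hd, hdx⟩ := hA.exists_supported_moving hG hab hCab ((h⁻¹).1 x)
    rw [← block_eq hx] at hd
    exact ((hq _).1 (hh d (hp.inHull hd))).mem ((conj_apply_apply_ne_iff h d _).2 hdx)
  · intro hCD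
    obtain ⟨h, hh, rfl⟩ := hG α β
    exact ⟨⟨h, hh⟩, fun y hy => hq.inHull ((((hp y).1 hy).conj ⟨h, hh⟩).mono (block_mono hCD))⟩

end LPermGroup

/-! ### Transfer of (††) and of the theory of the spine -/

theorem mainTheorem7 {Ω : Type*} {Λ : Type*} [LinearOrder Ω] [LinearOrder Λ]
    (G : LPermGroup Ω) (H : LPermGroup Λ)
    (hG_trans : G.IsTransitive) (hG_abundant : G.IsAbundant)
    (hG_dagger : G.Dagger) (hG_ddagger : G.DoubleDagger)
    (hH_trans : H.IsTransitive) (hH_abundant : H.IsAbundant) (hH_dagger : H.Dagger)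
    (hGH : LGroupElemEquiv G.toSubgroup H.toSubgroup) :
    H.DoubleDagger ∧ OrderElemEquiv G.spine H.spine := by
  constructor
  · rw [LPermGroup.doubleDagger_iff_hasIrreducibleOnHull hG_trans hG_abundant] at hG_ddagger
    rw [LPermGroup.doubleDagger_iff_hasIrreducibleOnHull hH_trans hH_abundant]
    exact (DefPair.iff_of_elemEquiv hGH
      (.all (.imp (.isRootParam .last) (.hasIrreducibleOnHull .last)))).1 hG_ddagger
  · refine orderElemEquiv_of_interpretation hGH
      -- A spine member is represented by a parameter of any one of its blocks.
      (R := fun g C => ∃ α, LPermGroup.Represents g (C.1.block α))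
      (S := fun g C => ∃ α, LPermGroup.Represents g (C.1.block α))
      (.isRootParam (.var ())) (.conjHullLE (.var false) (.var true)) ?_ ?_ ?_ ?_ ?_ ?_
    · rintro ⟨_, a, b, hab, rfl⟩
      obtain ⟨g, hg⟩ := LPermGroup.exists_represents hG_trans hG_abundant
        (LPermGroup.V_mem_spine hab) a
      exact ⟨g, a, hg⟩
    · rintro ⟨_, a, b, hab, rfl⟩
      obtain ⟨g, hg⟩ := LPermGroup.exists_represents hH_trans hH_abundant
        (LPermGroup.V_mem_spine hab) a
      exact ⟨g, a, hg⟩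
    · exact fun g => (LPermGroup.isRootParam_iff hG_trans hG_abundant).trans
        ⟨fun ⟨C, hC, h⟩ => ⟨⟨C, hC⟩, h⟩, fun ⟨C, h⟩ => ⟨C.1, C.2, h⟩⟩
    · exact fun g => (LPermGroup.isRootParam_iff hH_trans hH_abundant).trans
        ⟨fun ⟨C, hC, h⟩ => ⟨⟨C, hC⟩, h⟩, fun ⟨C, h⟩ => ⟨C.1, C.2, h⟩⟩
    · rintro p q C D ⟨α, hp⟩ ⟨β, hq⟩
      exact hp.conjHullLE_iff hG_trans hG_abundant C.2 hq
    · rintro p q C D ⟨α, hp⟩ ⟨β, hq⟩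
      exact hp.conjHullLE_iff hH_trans hH_abundant C.2 hq
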